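/- Let $\mathcal{A}$ be a complete and cocomplete abelian category (locally small; "set" means small set) in which every object is small: for each object $X$ there is a cardinal $\kappa$ such that for every ordinal $\gamma$ of cofinality greater than $\kappa$ and every colimit-preserving $\gamma$-indexed sequence $(Y^\alpha)_{\alpha<\gamma}$ in $\mathcal{A}$, the natural map $\operatorname{colim}_\alpha \mathcal{A}(X,Y^\alpha)\to\mathcal{A}(X,\operatorname{colim}_\alpha Y^\alpha)$ is an isomorphism. ("Small relative to a class $M$ of maps", in any category, means the same with only sequences all of whose maps lie in $M$.) A map $B\to C$ in $\mathcal{A}$ is $P$-epic if $\mathcal{A}(P,B)\to\mathcal{A}(P,C)$ is surjective, and it is $\mathcal{S}$-epic, for a collection $\mathcal{S}$ of objects, if it is $P$-epic for all $P\in\mathcal{S}$. A projective class is a pair consisting of a collection $\mathcal{P}$ of objects and a collection $\mathcal{E}$ of maps such that $\mathcal{E}$ is the collection of all $\mathcal{P}$-epic maps, $\mathcal{P}$ is the collection of all $P$ such that every map in $\mathcal{E}$ is $P$-epic, and every object $B$ admits a map $P\to B$ in $\mathcal{E}$ with $P\in\mathcal{P}$. It is determined by a subcollection $\mathcal{S}\subseteq\mathcal{P}$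 if a map is $\mathcal{S}$-epic exactly when it is $\mathcal{P}$-epic. Let $\mathcal{P}$ be any projective class on $\mathcal{A}$. A map $f$ in the category $\mathrm{Ch}(\mathcal{A})$ of unbounded chain complexes is a $\mathcal{P}$-equivalence (resp. a $\mathcal{P}$-fibration) if $\mathcal{A}(P,f)$ is a quasi-isomorphism (resp. degreewise surjective) for every $P\in\mathcal{P}$; it is a $\mathcal{P}$-cofibration if it has the left lifting property with respect to all maps that are both $\mathcal{P}$-fibrations and $\mathcal{P}$-equivalences. Then the following are equivalent: 1. $\mathcal{P}$ is determined by a set. 2. The $\mathcal{P}$-equivalences, $\mathcal{P}$-fibrations and $\mathcal{P}$-cofibrations form a model structure on $\mathrm{Ch}(\mathcal{A})$ (complete and cocomplete, with functorial factorizations), and it is cofibrantly generated: there are sets $I$ and $J$ of maps, with domains small relative to $I$-cof and $J$-cof respectively, such that $I$-cof is the class of $\mathcal{P}$-cofibrations and $J$-cof is the class of $\mathcal{P}$-cofibrations that are $\mathcal{P}$-equivalences. Here $I$-cof is the class of maps with the left lifting property with respect to all maps that have the right lifting property with respect to $I$. 3. The $\mathcal{P}$-equivalences, $\mathcal{P}$-fibrations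 and $\mathcal{P}$-cofibrations form a model structure on $\mathrm{Ch}(\mathcal{A})$, and the associated homotopy category (obtained by inverting the $\mathcal{P}$-equivalences) has a set of weak generators: a set $\mathcal{G}$ of objects such that each nonzero object receives a nonzero map from some $G\in\mathcal{G}$. Moreover, if 3 holds, then $\mathcal{P}$ is determined by a set of small objects, that is, by a set of objects of $\mathcal{P}$ each of which is small relative to the class of split monomorphisms whose cokernel lies in $\mathcal{P}$. -/

import Mathlib

open CategoryTheory CategoryTheory.Limits HomotopicalAlgebra

universe v u

namespace RelHom

section Smallness

variable {C : Type u} [Category.{v} C]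

/-- `X` is `κ`-small relative to the class `M` of maps: for each ordinal `γ` of cofinality greater
than `κ` and each colimit-preserving `γ`-sequence in `C` all of whose maps lie in `M`, the functor
`C(X, -)` preserves the colimit of the sequence. -/
def IsKappaSmallRel (M : MorphismProperty C) (κ : Cardinal.{v}) (X : C) : Prop :=
  ∀ (γ : Ordinal.{v}), κ < γ.cof → ∀ (F : γ.ToType ⥤ C), F.IsWellOrderContinuous →
    (∀ ⦃i j : γ.ToType⦄ (h : i ⟶ j), M (F.map h)) →
      PreservesColimit F (coyoneda.obj (Opposite.op X))

/-- `X` is small relative to `M` if it is `κ`-small relative to `M` for some cardinal `κ`. -/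
def IsSmallRel (M : MorphismProperty C) (X : C) : Prop :=
  ∃ κ : Cardinal.{v}, IsKappaSmallRel M κ X

/-- `X` is small: small relative to the whole category. -/
def IsSmallObject (X : C) : Prop :=
  IsSmallRel (⊤ : MorphismProperty C) X

end Smallness

section ModelStructures

variable {C : Type u} [Category.{v} C]

/-- The classes `W`, `Cof`, `Fib` are the weak equivalences, cofibrations and fibrations of a model
structure on `C`, where model categories are complete and cocomplete and have functorial
factorizations. -/
def FormsModelStructure (W Cof Fib : MorphismProperty C) : Prop :=
  HasLimits C ∧ HasColimits C ∧
  (∃ M : ModelCategory C,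
    M.categoryWithWeakEquivalences.weakEquivalences = W ∧
    M.categoryWithCofibrations.cofibrations = Cof ∧
    M.categoryWithFibrations.fibrations = Fib) ∧
  (Cof ⊓ W).HasFunctorialFactorization Fib ∧
  Cof.HasFunctorialFactorization (Fib ⊓ W)

/-- The generation condition for a model structure with weak equivalences `W` and cofibrations
`Cof`: there are sets `I` and `J` of maps, with domains small relative to `I`-cof and `J`-cof
respectively, such that `I`-cof is the class of cofibrations and `J`-cof is the class of trivial
cofibrations. Here `I`-cof is `I.rlp.llp`. -/
def IsCofibrantlyGenerated (W Cof : MorphismProperty C) : Prop :=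
  ∃ I J : MorphismProperty C,
    MorphismProperty.IsSmall.{v} I ∧ MorphismProperty.IsSmall.{v} J ∧
    (∀ ⦃A B : C⦄ (i : A ⟶ B), I i → IsSmallRel I.rlp.llp A) ∧
    (∀ ⦃A B : C⦄ (j : A ⟶ B), J j → IsSmallRel J.rlp.llp A) ∧
    I.rlp.llp = Cof ∧ J.rlp.llp = Cof ⊓ W

end ModelStructures

section WeakGenerators

universe w v' u'

variable {H : Type u'} [Category.{v'} H]

/-- A map is zero if it factors through a zero object. In a category with zero morphisms and a zero
object, such as an additive category, this is `f = 0`; see `isZeroMap_iff`. -/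
def IsZeroMap {X Y : H} (f : X ⟶ Y) : Prop :=
  ∃ (Z : H) (_ : IsZero Z) (a : X ⟶ Z) (b : Z ⟶ Y), a ≫ b = f

theorem isZeroMap_iff [HasZeroMorphisms H] [HasZeroObject H] {X Y : H} (f : X ⟶ Y) :
    IsZeroMap f ↔ f = 0 := by
  constructor
  · rintro ⟨Z, hZ, a, b, rfl⟩
    rw [hZ.eq_of_tgt a 0, zero_comp]
  · rintro rfl
    obtain ⟨Z, hZ⟩ := HasZeroObject.zero (C := H)
    exact ⟨Z, hZ, 0, 0, zero_comp⟩

variable (H) in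
/-- `H` has a (`w`-small) set of weak generators: a set `G` of objects such that every nonzero
object of `H` receives a nonzero map from an object in `G`. -/
def HasSetOfWeakGenerators : Prop :=
  ∃ G : Set H, Small.{w} G ∧
    ∀ X : H, ¬ IsZero X → ∃ g ∈ G, ∃ f : g ⟶ X, ¬ IsZeroMap f

end WeakGenerators

section ProjectiveClasses

variable {A : Type u} [Category.{v} A]

/-- The map `f : B ⟶ D` is `P`-epic: it induces a surjection of `P`-elements. -/
def IsElementEpic (P : A) {B D : A} (f : B ⟶ D) : Prop :=
  Function.Surjective (fun g : P ⟶ B => g ≫ f)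

variable (A) in
/-- A projective class: a collection of objects (the relative projectives) and a collection of maps
that determine each other, with enough relative projectives. -/
structure ProjectiveClass where
  /-- the relative projectives -/
  proj : Set A
  /-- the relative epimorphisms -/
  epi : MorphismProperty A
  epi_iff : ∀ ⦃B D : A⦄ (f : B ⟶ D), epi f ↔ ∀ P ∈ proj, IsElementEpic P f
  mem_proj_iff : ∀ P : A, P ∈ proj ↔ ∀ ⦃B D : A⦄ (f : B ⟶ D), epi f → IsElementEpic P f
  enough : ∀ B : A, ∃ P ∈ proj, ∃ f : P ⟶ B, epi f

namespace ProjectiveClass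

/-- `PC` is determined by the collection `S` of relative projectives. -/
def IsDeterminedBy (PC : ProjectiveClass A) (S : Set A) : Prop :=
  S ⊆ PC.proj ∧ ∀ ⦃B D : A⦄ (f : B ⟶ D),
    (∀ P ∈ S, IsElementEpic P f) ↔ (∀ P ∈ PC.proj, IsElementEpic P f)

/-- `PC` is determined by a set. -/
def IsDeterminedBySet (PC : ProjectiveClass A) : Prop :=
  ∃ S : Set A, Small.{v} S ∧ PC.IsDeterminedBy S

variable [Abelian A]

/-- The class of split monomorphisms with relatively projective cokernel. -/
def splitMonos (PC : ProjectiveClass A) : MorphismProperty A :=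
  fun _ _ f => IsSplitMono f ∧ cokernel f ∈ PC.proj

/-- `PC` is determined by a set of small objects, where small means small relative to the split
monomorphisms with relatively projective cokernel. -/
def IsDeterminedBySetOfSmallObjects (PC : ProjectiveClass A) : Prop :=
  ∃ S : Set A, Small.{v} S ∧ PC.IsDeterminedBy S ∧ ∀ P ∈ S, IsSmallRel PC.splitMonos P

end ProjectiveClass

/-- The functor `X ↦ A(P, X)` from unbounded chain complexes in `A` to unbounded chain complexes of
abelian groups, with `A(P, Xₙ)` in degree `n`. -/
noncomputable def elementsComplex [Abelian A] (P : A) :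
    ChainComplex A ℤ ⥤ ChainComplex AddCommGrpCat.{v} ℤ :=
  (preadditiveCoyoneda.obj (Opposite.op P)).mapHomologicalComplex (ComplexShape.down ℤ)

namespace ProjectiveClass

variable [Abelian A]

/-- The `PC`-equivalences: `A(P, f)` is a quasi-isomorphism for each relative projective `P`. -/
def equivalences (PC : ProjectiveClass A) : MorphismProperty (ChainComplex A ℤ) :=
  fun _ _ f => ∀ P ∈ PC.proj, QuasiIso ((elementsComplex P).map f)

/-- The `PC`-fibrations: `A(P, f)` is surjective (in each degree) for each relative projective
`P`. -/
def fibrations (PC : ProjectiveClass A) : MorphismProperty (ChainComplex A ℤ) :=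
  fun _ _ f => ∀ P ∈ PC.proj, ∀ n : ℤ, Function.Surjective (((elementsComplex P).map f).f n)

/-- The `PC`-cofibrations: the maps with the left lifting property with respect to all maps that are
both `PC`-fibrations and `PC`-equivalences. -/
def cofibrations (PC : ProjectiveClass A) : MorphismProperty (ChainComplex A ℤ) :=
  (PC.fibrations ⊓ PC.equivalences).llp

/-- The relative model structure exists. -/
def RelativeModelStructureExists (PC : ProjectiveClass A) : Prop :=
  FormsModelStructure PC.equivalences PC.cofibrations PC.fibrations

/-- The homotopy category of the relative model structure: chain complexes with the
`PC`-equivalences inverted. -/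
abbrev HomotopyCat (PC : ProjectiveClass A) :=
  PC.equivalences.Localization

end ProjectiveClass

end ProjectiveClasses

end RelHom

/-! Everything is tested on `P`-elements, and disks carry questions about maps of `A` to `Ch(A)`. A
map of complexes is a fibration and an equivalence iff it lifts cycles compatibly with boundaries
(`elementLifting_iff`). This is lifting against sphere-to-disk inclusions, and also `P`-epicness of
one family of maps of `A` not depending on `P` (`elementLifting_iff_corner`). A determining set
therefore gives generating cofibrations and, with maps from zero to disks, generating trivial
cofibrations; the small object argument and a path object give the model structure. Conversely, a
map into a disk is a map out of a single degree, so cofibrations are degreewise split monomorphisms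
with relatively projective cokernel, and the cokernels coming from a generating set determine the
class. For weak generators, spheres on a determining set detect nonexactness. In the other
direction, take the components of cofibrant replacements of the generators. If `g : B ⟶ C` is epic
for all of them, every map from a replacement to `ker g ⟶ B ⟶ C` factors through disks
(`isZeroMap_map_to_kernelComplex`). That complex is then zero in the homotopy category, hence exact
on `P`-elements, and exactness at `C` says that `g` is `P`-epic. -/

namespace RelHom

/-! ### Exactness and lifting on `P`-elements -/

variable {A : Type u} [Category.{v} A] [Abelian A]

/-- The complex of `P`-elements of `X` is exact. -/
def ElementExact (P : A) (X : ChainComplex A ℤ) : Prop :=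
  ∀ (n : ℤ) (x : P ⟶ X.X (n + 1)), x ≫ X.d (n + 1) n = 0 →
    ∃ y : P ⟶ X.X (n + 1 + 1), y ≫ X.d (n + 1 + 1) (n + 1) = x

lemma exactAt_elementsComplex_iff (P : A) (X : ChainComplex A ℤ) (n : ℤ) :
    ((elementsComplex P).obj X).ExactAt (n + 1) ↔
      ∀ x : P ⟶ X.X (n + 1), x ≫ X.d (n + 1) n = 0 →
        ∃ y : P ⟶ X.X (n + 1 + 1), y ≫ X.d (n + 1 + 1) (n + 1) = x := by
  rw [HomologicalComplex.exactAt_iff' _ (n + 1 + 1) (n + 1) n (by simp) (by simp),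
    ShortComplex.ab_exact_iff]
  rfl

lemma acyclic_elementsComplex_iff (P : A) (X : ChainComplex A ℤ) :
    ((elementsComplex P).obj X).Acyclic ↔ ElementExact P X := by
  refine ⟨fun h n => (exactAt_elementsComplex_iff P X n).1 (h _), fun h n => ?_⟩
  obtain ⟨n, rfl⟩ : ∃ m, n = m + 1 := ⟨n - 1, by simp⟩
  exact (exactAt_elementsComplex_iff P X n).2 (h n)

lemma quasiIso_of_acyclic_kernel {S : ShortComplex (ChainComplex AddCommGrpCat.{v} ℤ)}
    (hS : S.ShortExact) (h : S.X₁.Acyclic) : QuasiIso S.g := by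
  rw [quasiIso_iff]
  intro n
  rw [quasiIsoAt_iff_isIso_homologyMap]
  have h₁ : Mono (HomologicalComplex.homologyMap S.g n) :=
    (hS.homology_exact₂ n).mono_g ((h n).isZero_homology.eq_of_src _ _)
  have h₂ : Epi (HomologicalComplex.homologyMap S.g n) :=
    (hS.homology_exact₃ n (n - 1) (by simp)).epi_f ((h _).isZero_homology.eq_of_tgt _ _)
  exact isIso_of_mono_of_epi _

/-- Elementwise form of the right lifting property against the inclusions of spheres of `P` into
disks of `P`. -/
def ElementLifting (P : A) {X Y : ChainComplex A ℤ} (f : X ⟶ Y) : Prop :=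
  ∀ (n : ℤ) (x : P ⟶ X.X (n + 1)) (y : P ⟶ Y.X (n + 1 + 1)), x ≫ X.d (n + 1) n = 0 →
    y ≫ Y.d (n + 1 + 1) (n + 1) = x ≫ f.f (n + 1) →
      ∃ z : P ⟶ X.X (n + 1 + 1), z ≫ X.d (n + 1 + 1) (n + 1) = x ∧ z ≫ f.f (n + 1 + 1) = y

/-- `f` is surjective on `P`-elements in each degree. -/
def ElementSurjective (P : A) {X Y : ChainComplex A ℤ} (f : X ⟶ Y) : Prop :=
  ∀ n : ℤ, IsElementEpic P (f.f n)

lemma ElementSurjective.exists_comp_eq {P : A} {X Y : ChainComplex A ℤ} {f : X ⟶ Y}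
    (hf : ElementSurjective P f) {n : ℤ} (y : P ⟶ Y.X n) : ∃ x : P ⟶ X.X n, x ≫ f.f n = y :=
  hf n y

lemma kernel_ι_f_comp {X Y : ChainComplex A ℤ} (f : X ⟶ Y) (n : ℤ) :
    (kernel.ι f).f n ≫ f.f n = 0 := by
  rw [← HomologicalComplex.comp_f, kernel.condition, HomologicalComplex.zero_f]

lemma exists_comp_kernel_ι_f {P : A} {X Y : ChainComplex A ℤ} (f : X ⟶ Y) {n : ℤ}
    (x : P ⟶ X.X n) (hx : x ≫ f.f n = 0) :
    ∃ l : P ⟶ (kernel f).X n, l ≫ (kernel.ι f).f n = x :=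
  have ⟨l, hl⟩ := KernelFork.IsLimit.lift'
    (isLimitOfHasKernelOfPreservesLimit (HomologicalComplex.eval A _ n) f) x hx
  ⟨l, hl⟩

instance (P : A) : (elementsComplex P).PreservesZeroMorphisms :=
  inferInstanceAs ((preadditiveCoyoneda.obj (Opposite.op P)).mapHomologicalComplex
    (ComplexShape.down ℤ)).PreservesZeroMorphisms

lemma shortExact_elements_kernel (P : A) {X Y : ChainComplex A ℤ} (f : X ⟶ Y)
    (hf : ElementSurjective P f) :
    ((ShortComplex.mk (kernel.ι f) f (kernel.condition f)).map (elementsComplex P)).ShortExact := by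
  apply HomologicalComplex.shortExact_of_degreewise_shortExact
  intro n
  have hm : Mono ((kernel.ι f).f n) := inferInstance
  refine { exact := ?_, mono_f := ?_, epi_g := ?_ }
  · rw [ShortComplex.ab_exact_iff]
    exact fun x hx => exists_comp_kernel_ι_f f x hx
  · rw [AddCommGrpCat.mono_iff_injective]
    intro (x : P ⟶ _) (y : P ⟶ _) (hxy : x ≫ (kernel.ι f).f n = y ≫ (kernel.ι f).f n)
    exact (cancel_mono _).1 hxy
  · rw [AddCommGrpCat.epi_iff_surjective]
    exact hf n

lemma elementExact_kernel_iff (P : A) {X Y : ChainComplex A ℤ} (f : X ⟶ Y) :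
    ElementExact P (kernel f) ↔ ∀ (n : ℤ) (x : P ⟶ X.X (n + 1)), x ≫ X.d (n + 1) n = 0 →
      x ≫ f.f (n + 1) = 0 → ∃ y : P ⟶ X.X (n + 1 + 1), y ≫ X.d (n + 1 + 1) (n + 1) = x ∧
        y ≫ f.f (n + 1 + 1) = 0 := by
  have hm (n : ℤ) : Mono ((kernel.ι f).f n) := inferInstance
  constructor
  · intro h n x hx hx'
    obtain ⟨l, hl⟩ := exists_comp_kernel_ι_f f x hx'
    obtain ⟨y, hy⟩ := h n l (by
      rw [← cancel_mono ((kernel.ι f).f n), Category.assoc, ← (kernel.ι f).comm,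
        reassoc_of% hl, hx, zero_comp])
    refine ⟨y ≫ (kernel.ι f).f _, ?_, by rw [Category.assoc, kernel_ι_f_comp, comp_zero]⟩
    rw [Category.assoc, (kernel.ι f).comm, reassoc_of% hy, hl]
  · intro h n x hx
    obtain ⟨y, hy, hy'⟩ := h n (x ≫ (kernel.ι f).f _)
      (by rw [Category.assoc, (kernel.ι f).comm, reassoc_of% hx, zero_comp])
      (by rw [Category.assoc, kernel_ι_f_comp, comp_zero])
    obtain ⟨l, hl⟩ := exists_comp_kernel_ι_f f y hy'
    refine ⟨l, ?_⟩
    rw [← cancel_mono ((kernel.ι f).f (n + 1)), Category.assoc, ← (kernel.ι f).comm,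
      reassoc_of% hl, hy]

/-- Two lifts are needed: the boundary of `y` is first lifted to a cycle `x`, and then `y` is lifted
to a chain with boundary `x`. -/
lemma ElementLifting.elementSurjective {P : A} {X Y : ChainComplex A ℤ} {f : X ⟶ Y}
    (hf : ElementLifting P f) : ElementSurjective P f := by
  intro n y
  obtain ⟨n, rfl⟩ : ∃ m, n = m + 1 + 1 + 1 := ⟨n - 1 - 1 - 1, by simp⟩
  obtain ⟨x, hx, hx'⟩ := hf n 0 (y ≫ Y.d _ _) (by simp) (by simp)
  obtain ⟨z, -, hz⟩ := hf (n + 1) x y hx hx'.symm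
  exact ⟨z, hz⟩

/-- For a surjection on elements, the long exact sequence identifies being a quasi-isomorphism with
exactness of the kernel, which is the lifting condition for `y = 0`. -/
lemma elementLifting_iff (P : A) {X Y : ChainComplex A ℤ} (f : X ⟶ Y) :
    ElementLifting P f ↔ ElementSurjective P f ∧ QuasiIso ((elementsComplex P).map f) := by
  have key (hf : ElementSurjective P f) :
      QuasiIso ((elementsComplex P).map f) ↔ ElementExact P (kernel f) := by
    have hS := shortExact_elements_kernel P f hf
    rw [← acyclic_elementsComplex_iff]
    exact ⟨fun h => hS.acyclic_X₁ h, fun h => quasiIso_of_acyclic_kernel hS h⟩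
  constructor
  · intro h
    refine ⟨h.elementSurjective, (key h.elementSurjective).2 ((elementExact_kernel_iff P f).2 ?_)⟩
    intro n x hx hx'
    exact h n x 0 hx (by simp [hx'])
  · rintro ⟨h, h'⟩ n x y hx hy
    rw [key h, elementExact_kernel_iff] at h'
    -- An arbitrary lift `z` of `y` has the wrong boundary; the error `x - dz` is a cycle of the
    -- kernel, hence the boundary of a correction `w` there.
    obtain ⟨z, hz⟩ := h.exists_comp_eq y
    obtain ⟨w, hw, hw'⟩ := h' n (x - z ≫ X.d _ _)
      (by simpa [Preadditive.sub_comp] using hx)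
      (by rw [Preadditive.sub_comp, Category.assoc, ← f.comm, reassoc_of% hz, hy, sub_self])
    exact ⟨z + w, by simp [hw], by simp [hw', hz]⟩

/-- The map from `Xₙ₊₂` to the pairs of an `(n+2)`-chain of `Y` and an `(n+1)`-cycle of `X` with
the same image in `Yₙ₊₁`. -/
noncomputable def corner {X Y : ChainComplex A ℤ} (f : X ⟶ Y) (n : ℤ) :
    X.X (n + 1 + 1) ⟶
      pullback (Y.d (n + 1 + 1) (n + 1)) (kernel.ι (X.d (n + 1) n) ≫ f.f (n + 1)) :=
  pullback.lift (f.f (n + 1 + 1)) (kernel.lift _ (X.d (n + 1 + 1) (n + 1)) (by simp)) (by simp)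

lemma corner_fst {X Y : ChainComplex A ℤ} (f : X ⟶ Y) (n : ℤ) :
    corner f n ≫ pullback.fst _ _ = f.f (n + 1 + 1) :=
  pullback.lift_fst _ _ _

lemma corner_snd_ι {X Y : ChainComplex A ℤ} (f : X ⟶ Y) (n : ℤ) :
    corner f n ≫ pullback.snd _ _ ≫ kernel.ι _ = X.d (n + 1 + 1) (n + 1) := by
  rw [corner, pullback.lift_snd_assoc, kernel.lift_ι]

/-- The maps `corner f n` live in `A` and do not depend on `P`. This is what allows a lifting
condition to pass from a determining set to all relative projectives. -/
lemma elementLifting_iff_corner (P : A) {X Y : ChainComplex A ℤ} (f : X ⟶ Y) :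
    ElementLifting P f ↔ ∀ n, IsElementEpic P (corner f n) := by
  constructor
  · intro h n y
    obtain ⟨z, hz, hz'⟩ := h n (y ≫ pullback.snd _ _ ≫ kernel.ι _) (y ≫ pullback.fst _ _)
      (by simp) (by simp [pullback.condition])
    refine ⟨z, pullback.hom_ext ?_ ?_⟩
    · dsimp only
      rw [Category.assoc, corner_fst, hz']
    · rw [← cancel_mono (kernel.ι _)]
      dsimp only
      rw [Category.assoc, Category.assoc, Category.assoc, corner_snd_ι, hz]
  · intro h n x y hx hy
    obtain ⟨z, hz⟩ := h n (pullback.lift y (kernel.lift _ x hx) (by simp [hy]))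
    dsimp only at hz
    refine ⟨z, ?_, ?_⟩
    · rw [← corner_snd_ι f, reassoc_of% hz, pullback.lift_snd_assoc, kernel.lift_ι]
    · rw [← corner_fst f, reassoc_of% hz, pullback.lift_fst]

namespace ProjectiveClass

variable (PC : ProjectiveClass A)

lemma fibrations_iff {X Y : ChainComplex A ℤ} (f : X ⟶ Y) :
    PC.fibrations f ↔ ∀ P ∈ PC.proj, ElementSurjective P f := Iff.rfl

lemma fibrations_inf_equivalences_iff {X Y : ChainComplex A ℤ} (f : X ⟶ Y) :
    (PC.fibrations ⊓ PC.equivalences) f ↔ ∀ P ∈ PC.proj, ElementLifting P f := by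
  simp only [elementLifting_iff]
  exact ⟨fun h P hP => ⟨h.1 P hP, h.2 P hP⟩, fun h => ⟨fun P hP => (h P hP).1,
    fun P hP => (h P hP).2⟩⟩

lemma homotopyEquivalences_le :
    HomologicalComplex.homotopyEquivalences A (ComplexShape.down ℤ) ≤ PC.equivalences := by
  rintro X Y _ ⟨e, rfl⟩ P _
  exact ((preadditiveCoyoneda.obj (Opposite.op P)).mapHomotopyEquiv e).quasiIso_hom

instance : PC.equivalences.HasTwoOutOfThreeProperty where
  comp_mem f g hf hg P hP := by
    have := hf P hP
    have := hg P hP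
    rw [Functor.map_comp]
    infer_instance
  of_postcomp f g hg hfg P hP := by
    have := hg P hP
    have := hfg P hP
    rw [Functor.map_comp] at this
    exact quasiIso_of_comp_right _ ((elementsComplex P).map g)
  of_precomp f g hf hfg P hP := by
    have := hf P hP
    have := hfg P hP
    rw [Functor.map_comp] at this
    exact quasiIso_of_comp_left ((elementsComplex P).map f) _

end ProjectiveClass

/-! ### Disks and spheres -/

lemma down_rel (n : ℤ) : (ComplexShape.down ℤ).Rel (n + 1) n := rfl

/-- The complex with `P` in degrees `n + 1` and `n` and the identity as differential. -/
noncomputable def disk (P : A) (n : ℤ) : ChainComplex A ℤ :=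
  HomologicalComplex.double (𝟙 P) (down_rel n)

/-- The complex with `P` in degree `n`. -/
noncomputable def sphere (P : A) (n : ℤ) : ChainComplex A ℤ :=
  (HomologicalComplex.single A _ n).obj P

/-- The top degree part of a disk. -/
noncomputable def diskXTop (P : A) (n : ℤ) : (disk P n).X (n + 1) ≅ P :=
  HomologicalComplex.doubleXIso₀ (𝟙 P) (down_rel n)

/-- The bottom degree part of a disk. -/
noncomputable def diskXBot (P : A) (n : ℤ) : (disk P n).X n ≅ P :=
  HomologicalComplex.doubleXIso₁ (𝟙 P) (down_rel n) (by simp)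

/-- The nonzero degree part of a sphere. -/
noncomputable def sphereX (P : A) (n : ℤ) : (sphere P n).X n ≅ P :=
  HomologicalComplex.singleObjXSelf _ n P

lemma disk_d (P : A) (n : ℤ) :
    (disk P n).d (n + 1) n = (diskXTop P n).hom ≫ (diskXBot P n).inv := by
  refine (HomologicalComplex.double_d _ _ (by simp)).trans ?_
  rw [Category.id_comp]
  rfl

/-- The map from a disk given by an element of the target. -/
noncomputable def diskDesc {P : A} {n : ℤ} {X : ChainComplex A ℤ} (x : P ⟶ X.X (n + 1)) :
    disk P n ⟶ X :=
  HomologicalComplex.mkHomFromDouble _ (by simp) x (x ≫ X.d _ _) (by simp) (by simp)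

lemma diskDesc_f_top {P : A} {n : ℤ} {X : ChainComplex A ℤ} (x : P ⟶ X.X (n + 1)) :
    (diskDesc x).f (n + 1) = (diskXTop P n).hom ≫ x :=
  HomologicalComplex.mkHomFromDouble_f₀ _ _ _ _ _ _

lemma diskDesc_f_bot {P : A} {n : ℤ} {X : ChainComplex A ℤ} (x : P ⟶ X.X (n + 1)) :
    (diskDesc x).f n = (diskXBot P n).hom ≫ x ≫ X.d _ _ :=
  HomologicalComplex.mkHomFromDouble_f₁ _ _ _ _ _ _

lemma disk_hom_ext {P : A} {n : ℤ} {X : ChainComplex A ℤ} {f g : disk P n ⟶ X}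
    (h : (diskXTop P n).inv ≫ f.f (n + 1) = (diskXTop P n).inv ≫ g.f (n + 1)) : f = g := by
  have h₁ : f.f (n + 1) = g.f (n + 1) := by rwa [cancel_epi] at h
  refine HomologicalComplex.from_double_hom_ext h₁ ?_
  change f.f n = g.f n
  have hf := f.comm (n + 1) n
  have hg := g.comm (n + 1) n
  rw [disk_d] at hf hg
  rw [← cancel_epi ((diskXTop P n).hom ≫ (diskXBot P n).inv), ← hf, ← hg, h₁]

/-- The map to a disk given by a map out of the source in its bottom degree. -/
noncomputable def toDisk {M : A} {n : ℤ} {X : ChainComplex A ℤ} (x : X.X n ⟶ M) :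
    X ⟶ disk M n where
  f k := if h : k = n + 1 then
      (X.XIsoOfEq h).hom ≫ X.d _ _ ≫ x ≫ (diskXTop M n).inv ≫
        ((disk M n).XIsoOfEq h).inv
    else if h' : k = n then
      (X.XIsoOfEq h').hom ≫ x ≫ (diskXBot M n).inv ≫ ((disk M n).XIsoOfEq h').inv
    else 0
  comm' i j (hij : j + 1 = i) := by
    subst hij
    by_cases h : j = n
    · subst h
      simp [disk_d]
    · have h' : j + 1 ≠ n + 1 := by simpa using h
      have h₀ : (disk M n).d (j + 1) j = 0 := HomologicalComplex.double_d_eq_zero₁ _ _ _ _ h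
      rw [h₀, comp_zero]
      by_cases h₁ : j = n + 1
      · subst h₁
        simp
      · rw [dif_neg h₁, dif_neg h, comp_zero]

lemma toDisk_f_top {M : A} {n : ℤ} {X : ChainComplex A ℤ} (x : X.X n ⟶ M) :
    (toDisk x).f (n + 1) = X.d _ _ ≫ x ≫ (diskXTop M n).inv := by
  simp [toDisk]

lemma toDisk_f_bot {M : A} {n : ℤ} {X : ChainComplex A ℤ} (x : X.X n ⟶ M) :
    (toDisk x).f n = x ≫ (diskXBot M n).inv := by
  simp [toDisk]

lemma to_disk_hom_ext {M : A} {n : ℤ} {X : ChainComplex A ℤ} {f g : X ⟶ disk M n}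
    (h : f.f n ≫ (diskXBot M n).hom = g.f n ≫ (diskXBot M n).hom) : f = g := by
  have h₁ : f.f n = g.f n := by rwa [cancel_mono] at h
  refine HomologicalComplex.to_double_hom_ext ?_ h₁
  change f.f (n + 1) = g.f (n + 1)
  have hf := f.comm (n + 1) n
  have hg := g.comm (n + 1) n
  rw [disk_d] at hf hg
  rw [← cancel_mono ((diskXTop M n).hom ≫ (diskXBot M n).inv), hf, hg, h₁]

/-- The map of disks induced by a map. -/
noncomputable def diskMap {B C : A} (g : B ⟶ C) (n : ℤ) : disk B n ⟶ disk C n :=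
  toDisk ((diskXBot B n).hom ≫ g)

lemma toDisk_diskMap {B C : A} (g : B ⟶ C) {n : ℤ} {X : ChainComplex A ℤ} (x : X.X n ⟶ B) :
    toDisk x ≫ diskMap g n = toDisk (x ≫ g) := by
  apply to_disk_hom_ext
  simp [diskMap, toDisk_f_bot]

lemma eq_toDisk {M : A} {n : ℤ} {X : ChainComplex A ℤ} (f : X ⟶ disk M n) :
    f = toDisk (f.f n ≫ (diskXBot M n).hom) := by
  apply to_disk_hom_ext
  simp [toDisk_f_bot]

lemma comp_toDisk {M : A} {n : ℤ} {X Y : ChainComplex A ℤ} (f : X ⟶ Y) (y : Y.X n ⟶ M) :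
    f ≫ toDisk y = toDisk (f.f n ≫ y) := by
  apply to_disk_hom_ext
  simp [toDisk_f_bot]

/-- `disk · n` is right adjoint to evaluation in degree `n`, so lifting problems transpose. -/
lemma hasLiftingProperty_diskMap_iff {X Y : ChainComplex A ℤ} (i : X ⟶ Y) {B C : A} (g : B ⟶ C)
    (n : ℤ) : HasLiftingProperty i (diskMap g n) ↔ HasLiftingProperty (i.f n) g := by
  constructor
  · intro h
    refine ⟨fun {u w} sq => ?_⟩
    have sq' : CommSq (toDisk u) i (diskMap g n) (toDisk w) :=
      ⟨by rw [toDisk_diskMap, comp_toDisk, sq.w]⟩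
    refine ⟨⟨⟨sq'.lift.f n ≫ (diskXBot B n).hom, ?_, ?_⟩⟩⟩
    · rw [← HomologicalComplex.comp_f_assoc, sq'.fac_left]
      simp [toDisk_f_bot]
    · have := congrArg (fun f => HomologicalComplex.Hom.f f n ≫ (diskXBot C n).hom) sq'.fac_right
      simpa only [HomologicalComplex.comp_f, diskMap, toDisk_f_bot, Category.assoc,
        Iso.inv_hom_id, Category.comp_id] using this
  · intro h
    refine ⟨fun {u w} sq => ?_⟩
    have sq' : CommSq (u.f n ≫ (diskXBot B n).hom) (i.f n) g (w.f n ≫ (diskXBot C n).hom) := by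
      have := congrArg (fun f => HomologicalComplex.Hom.f f n ≫ (diskXBot C n).hom) sq.w
      exact ⟨by simpa [diskMap, toDisk_f_bot] using this⟩
    refine ⟨⟨⟨toDisk sq'.lift, ?_, ?_⟩⟩⟩
    · rw [comp_toDisk, sq'.fac_left, ← eq_toDisk]
    · rw [toDisk_diskMap, sq'.fac_right, ← eq_toDisk]

/-- A cycle of `X` gives a map from a sphere. -/
noncomputable def sphereDesc {P : A} {n : ℤ} {X : ChainComplex A ℤ} (x : P ⟶ X.X (n + 1))
    (hx : x ≫ X.d (n + 1) n = 0) : sphere P (n + 1) ⟶ X :=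
  HomologicalComplex.mkHomFromSingle x (fun k (hk : k + 1 = n + 1) => by
    obtain rfl : k = n := by simpa using hk
    exact hx)

lemma sphereDesc_f {P : A} {n : ℤ} {X : ChainComplex A ℤ} (x : P ⟶ X.X (n + 1))
    (hx : x ≫ X.d (n + 1) n = 0) :
    (sphereDesc x hx).f (n + 1) = (sphereX P (n + 1)).hom ≫ x :=
  HomologicalComplex.mkHomFromSingle_f _ _

lemma sphere_d (P : A) (n i j : ℤ) : (sphere P n).d i j = 0 := rfl

lemma sphere_hom_ext {P : A} {n : ℤ} {X : ChainComplex A ℤ} {f g : sphere P n ⟶ X}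
    (h : (sphereX P n).inv ≫ f.f n = (sphereX P n).inv ≫ g.f n) : f = g :=
  HomologicalComplex.from_single_hom_ext (by rwa [cancel_epi] at h)

/-- The inclusion of a sphere into a disk as its bottom degree. -/
noncomputable def sphereToDisk (P : A) (n : ℤ) : sphere P (n + 1) ⟶ disk P (n + 1) :=
  sphereDesc (diskXBot P (n + 1)).inv (by
    have h : (disk P (n + 1)).d (n + 1) n = 0 :=
      HomologicalComplex.double_d_eq_zero₀ _ _ _ _ (by simp)
    rw [h, comp_zero])

lemma sphereToDisk_f (P : A) (n : ℤ) :
    (sphereToDisk P n).f (n + 1) = (sphereX P (n + 1)).hom ≫ (diskXBot P (n + 1)).inv :=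
  sphereDesc_f _ _

/-- Maps from the sphere are cycles and maps from the disk are chains of degree one higher;
restriction to the sphere takes the boundary. -/
lemma elementLifting_iff_hasLiftingProperty (P : A) {X Y : ChainComplex A ℤ} (f : X ⟶ Y) :
    ElementLifting P f ↔ ∀ n, HasLiftingProperty (sphereToDisk P n) f := by
  constructor
  · intro h n
    refine ⟨fun {u w} sq => ?_⟩
    have hu : ((sphereX P (n + 1)).inv ≫ u.f (n + 1)) ≫ X.d (n + 1) n = 0 := by
      rw [Category.assoc, u.comm, sphere_d, zero_comp, comp_zero]
    have hw : ((diskXTop P (n + 1)).inv ≫ w.f (n + 1 + 1)) ≫ Y.d (n + 1 + 1) (n + 1) =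
        ((sphereX P (n + 1)).inv ≫ u.f (n + 1)) ≫ f.f (n + 1) := by
      rw [Category.assoc, w.comm, disk_d, Category.assoc, Category.assoc, Iso.inv_hom_id_assoc,
        ← HomologicalComplex.comp_f, sq.w, HomologicalComplex.comp_f, sphereToDisk_f,
        Category.assoc, Iso.inv_hom_id_assoc]
    obtain ⟨z, hz, hz'⟩ := h n _ _ hu hw
    refine ⟨⟨⟨diskDesc z, sphere_hom_ext ?_, disk_hom_ext ?_⟩⟩⟩
    · rw [HomologicalComplex.comp_f, sphereToDisk_f, Category.assoc, Iso.inv_hom_id_assoc,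
        diskDesc_f_bot, Iso.inv_hom_id_assoc, hz]
    · rw [HomologicalComplex.comp_f, reassoc_of% diskDesc_f_top (P := P), Iso.inv_hom_id_assoc, hz']
  · intro h n x y hx hy
    have sq : CommSq (sphereDesc x hx) (sphereToDisk P n) f (diskDesc y) := by
      refine ⟨sphere_hom_ext ?_⟩
      rw [HomologicalComplex.comp_f, HomologicalComplex.comp_f, sphereDesc_f, sphereToDisk_f,
        diskDesc_f_bot, hy]
      simp
    have := h n
    have h₁ := congrArg (fun g => (sphereX P (n + 1)).inv ≫ HomologicalComplex.Hom.f g (n + 1))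
      sq.fac_left
    have h₂ := congrArg (fun g => (diskXTop P (n + 1)).inv ≫
      HomologicalComplex.Hom.f g (n + 1 + 1)) sq.fac_right
    refine ⟨(diskXTop P (n + 1)).inv ≫ sq.lift.f _, ?_, ?_⟩
    · rw [HomologicalComplex.comp_f, sphereToDisk_f, Category.assoc, Iso.inv_hom_id_assoc,
        sphereDesc_f, Iso.inv_hom_id_assoc] at h₁
      rw [Category.assoc, sq.lift.comm, disk_d, Category.assoc, Iso.inv_hom_id_assoc, h₁]
    · rw [HomologicalComplex.comp_f, diskDesc_f_top, Iso.inv_hom_id_assoc] at h₂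
      rw [Category.assoc, h₂]

lemma elementSurjective_iff_hasLiftingProperty (P : A) {Z X Y : ChainComplex A ℤ} (hZ : IsZero Z)
    (f : X ⟶ Y) : ElementSurjective P f ↔
      ∀ n, HasLiftingProperty (hZ.to_ (disk P n)) f := by
  constructor
  · intro h n
    refine ⟨fun {u w} sq => ?_⟩
    obtain ⟨x, hx⟩ := h.exists_comp_eq ((diskXTop P n).inv ≫ w.f (n + 1))
    refine ⟨⟨⟨diskDesc x, hZ.eq_of_src _ _, disk_hom_ext ?_⟩⟩⟩
    rw [HomologicalComplex.comp_f, reassoc_of% diskDesc_f_top (P := P), Iso.inv_hom_id_assoc, hx]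
  · intro h n y
    obtain ⟨n, rfl⟩ : ∃ m, n = m + 1 := ⟨n - 1, by simp⟩
    have sq : CommSq (hZ.to_ X) (hZ.to_ (disk P n)) f (diskDesc y) := ⟨hZ.eq_of_src _ _⟩
    have := h n
    refine ⟨(diskXTop P n).inv ≫ sq.lift.f _, ?_⟩
    dsimp only
    rw [Category.assoc, ← HomologicalComplex.comp_f, sq.fac_right, diskDesc_f_top,
      Iso.inv_hom_id_assoc]

/-! ### Smallness and generating sets -/

section

variable {C : Type u} [Category.{v} C]

lemma IsSmallObject.isSmallRel {X : C} (h : IsSmallObject X) (M : MorphismProperty C) :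
    IsSmallRel M X := by
  obtain ⟨κ, hκ⟩ := h
  exact ⟨κ, fun γ hγ F hF _ => hκ γ hγ F hF fun _ _ _ => trivial⟩

lemma hasSmallObjectArgument_of_isSmallObject [HasColimits C] (I : MorphismProperty C)
    [hI : MorphismProperty.IsSmall.{v} I]
    (h : ∀ ⦃X Y : C⦄ (i : X ⟶ Y), I i → IsSmallObject X) :
    MorphismProperty.HasSmallObjectArgument.{v} I := by
  obtain ⟨ι, X, Y, f, rfl⟩ := I.isSmall_iff_eq_ofHoms.1 hI
  choose k hk using fun i => h (f i) ⟨i⟩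
  -- A successor of an infinite cardinal is regular, so the cofinality of `κ.ord` is `κ`, which
  -- exceeds all the bounds `k i` at once.
  let κ : Cardinal.{v} := Order.succ (max Cardinal.aleph0 (⨆ i, k i))
  have hκ : κ.IsRegular := Cardinal.isRegular_succ (le_max_left _ _)
  have hk' (i : ι) : k i < κ :=
    Order.lt_succ_of_le ((le_ciSup (Cardinal.bddAbove_of_small) i).trans (le_max_right _ _))
  have hκ' : Fact κ.IsRegular := ⟨hκ⟩
  have hne : Nonempty κ.ord.ToType := by
    rw [Ordinal.nonempty_toType_iff]
    exact hκ.ord_pos.ne'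
  let : OrderBot κ.ord.ToType := WellFoundedLT.toOrderBot _
  refine ⟨κ, hκ', inferInstance, { preservesColimit := ?_ }⟩
  rintro X' Y' Z W _ ⟨i⟩ g hg
  exact hk i κ.ord (by rw [hκ.cof_ord]; exact hk' i) hg.F inferInstance fun _ _ _ => trivial

end

section

/-- Maps from the sphere on `P` are the cycles in the complex of `P`-elements. -/
lemma exists_sphereDesc_eq {P : A} {n : ℤ} {X : ChainComplex A ℤ} (f : sphere P (n + 1) ⟶ X) :
    ∃ (x : P ⟶ X.X (n + 1)) (hx : x ≫ X.d (n + 1) n = 0), f = sphereDesc x hx := by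
  refine ⟨(sphereX P (n + 1)).inv ≫ f.f (n + 1), ?_, sphere_hom_ext ?_⟩
  · rw [Category.assoc, f.comm, sphere_d, zero_comp, comp_zero]
  · rw [sphereDesc_f, Iso.inv_hom_id_assoc]

lemma sphereDesc_comp {P : A} {n : ℤ} {X Y : ChainComplex A ℤ} (x : P ⟶ X.X (n + 1))
    (hx : x ≫ X.d (n + 1) n = 0) (f : X ⟶ Y) :
    sphereDesc x hx ≫ f = sphereDesc (x ≫ f.f (n + 1))
      (by rw [Category.assoc, f.comm, reassoc_of% hx, zero_comp]) := by
  apply sphere_hom_ext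
  rw [HomologicalComplex.comp_f, sphereDesc_f, sphereDesc_f, Category.assoc]

/-- Colimits of complexes are degreewise, and cycles are the kernel of the differential, so taking
them commutes with a filtered colimit that is preserved on `P`-elements in each degree. -/
lemma isSmallObject_sphere [HasColimits A] {P : A} (hP : IsSmallObject P) (n : ℤ) :
    IsSmallObject (sphere P n) := by
  obtain ⟨n, rfl⟩ : ∃ m, n = m + 1 := ⟨n - 1, by simp⟩
  obtain ⟨κ, hκ⟩ := hP
  refine ⟨κ, fun γ hγ F hF _ => ?_⟩
  -- The index must be nonempty to be filtered; the cofinality bound excludes `γ = 0`.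
  have hne : Nonempty γ.ToType := by
    rw [Ordinal.nonempty_toType_iff]
    rintro rfl
    simp at hγ
  have hP (k : ℤ) : PreservesColimit (F ⋙ HomologicalComplex.eval A _ k)
      (coyoneda.obj (Opposite.op P)) :=
    hκ γ hγ _ ⟨fun j hj => ⟨isColimitOfPreserves (HomologicalComplex.eval A _ k)
      (F.isColimitOfIsWellOrderContinuous j hj)⟩⟩ fun _ _ _ => trivial
  let hc := colimit.isColimit F
  let hk (k : ℤ) := isColimitOfPreserves (coyoneda.obj (Opposite.op P))
    (isColimitOfPreserves (HomologicalComplex.eval A _ k) hc)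
  have surj (k : ℤ) (x : P ⟶ (colimit F).X k) :
      ∃ (i : γ.ToType) (y : P ⟶ (F.obj i).X k), y ≫ (colimit.ι F i).f k = x :=
    Types.jointly_surjective_of_isColimit (hk k) x
  have inj (k : ℤ) (i : γ.ToType) (x y : P ⟶ (F.obj i).X k)
      (h : x ≫ (colimit.ι F i).f k = y ≫ (colimit.ι F i).f k) :
      ∃ (j : γ.ToType) (f : i ⟶ j), x ≫ (F.map f).f k = y ≫ (F.map f).f k :=
    (Types.FilteredColimit.isColimit_eq_iff' (hk k) x y).1 h
  refine preservesColimit_of_preserves_colimit_cocone hc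
    (Types.FilteredColimit.isColimitOf' _ _ ?_ ?_)
  · intro (x : sphere P (n + 1) ⟶ colimit F)
    obtain ⟨x, hx, rfl⟩ := exists_sphereDesc_eq x
    obtain ⟨i, y, rfl⟩ := surj _ x
    -- The representative `y` need not be a cycle, but its boundary vanishes in the colimit and so
    -- already at a later stage `j`.
    obtain ⟨j, f, hf⟩ := inj n i (y ≫ (F.obj i).d (n + 1) n) 0
      (by rw [Category.assoc, ← (colimit.ι F i).comm, ← Category.assoc, hx, zero_comp])
    refine ⟨j, sphereDesc (y ≫ (F.map f).f _)
      (by rw [Category.assoc, (F.map f).comm, ← Category.assoc, hf, zero_comp]), ?_⟩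
    refine Eq.trans ?_ (sphereDesc_comp _ _ (colimit.ι F j)).symm
    congr 1
    rw [Category.assoc, ← HomologicalComplex.comp_f, colimit.w]
  · intro i (x : sphere P (n + 1) ⟶ F.obj i) (y : sphere P (n + 1) ⟶ F.obj i)
      (h : x ≫ colimit.ι F i = y ≫ colimit.ι F i)
    obtain ⟨j, f, hf⟩ := inj (n + 1) i ((sphereX P (n + 1)).inv ≫ x.f (n + 1))
      ((sphereX P (n + 1)).inv ≫ y.f (n + 1)) (by
        rw [Category.assoc, Category.assoc, ← HomologicalComplex.comp_f, h,
          HomologicalComplex.comp_f])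
    refine ⟨j, f, sphere_hom_ext ?_⟩
    change (sphereX P (n + 1)).inv ≫ (x ≫ F.map f).f _ =
      (sphereX P (n + 1)).inv ≫ (y ≫ F.map f).f _
    rw [HomologicalComplex.comp_f, HomologicalComplex.comp_f, ← Category.assoc, hf,
      Category.assoc]

lemma isZero_sphere {P : A} (hP : IsZero P) (n : ℤ) : IsZero (sphere P n) := by
  rw [IsZero.iff_id_eq_zero]
  apply sphere_hom_ext
  rw [← cancel_epi (sphereX P n).hom]
  exact (hP.of_iso (sphereX P n)).eq_of_src _ _

end

lemma rlp_ofHoms_iff {C : Type*} [Category* C] {ι : Type*} {X Y : ι → C} (f : ∀ i, X i ⟶ Y i)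
    {Z W : C} (p : Z ⟶ W) :
    (MorphismProperty.ofHoms f).rlp p ↔ ∀ i, HasLiftingProperty (f i) p :=
  ⟨fun h i => h _ ⟨i⟩, by rintro h _ _ _ ⟨i⟩; exact h i⟩

/-- The inclusions of spheres of objects of `S` into disks. -/
def generatingCofibrations (S : Set A) : MorphismProperty (ChainComplex A ℤ) :=
  MorphismProperty.ofHoms fun p : S × ℤ => sphereToDisk p.1.1 p.2

/-- The maps from a zero complex to disks of objects of `S`. -/
def generatingTrivialCofibrations (S : Set A) {Z : ChainComplex A ℤ} (hZ : IsZero Z) :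
    MorphismProperty (ChainComplex A ℤ) :=
  MorphismProperty.ofHoms fun p : S × ℤ => hZ.to_ (disk p.1.1 p.2)

instance (S : Set A) [Small.{v} S] : MorphismProperty.IsSmall.{v} (generatingCofibrations S) := by
  have : Small.{v} (S × ℤ) := inferInstance
  exact MorphismProperty.isSmall_ofHoms _

instance (S : Set A) [Small.{v} S] {Z : ChainComplex A ℤ} (hZ : IsZero Z) :
    MorphismProperty.IsSmall.{v} (generatingTrivialCofibrations S hZ) := by
  have : Small.{v} (S × ℤ) := inferInstance
  exact MorphismProperty.isSmall_ofHoms _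

instance {C : Type u} [Category.{v} C] [HasZeroMorphisms C] {ι : Type} (c : ComplexShape ι)
    [HasLimits C] : HasLimits (HomologicalComplex C c) :=
  ⟨fun _ _ => inferInstance⟩

instance {C : Type u} [Category.{v} C] [HasZeroMorphisms C] {ι : Type} (c : ComplexShape ι)
    [HasColimits C] : HasColimits (HomologicalComplex C c) :=
  ⟨fun _ _ => inferInstance⟩

/-! ### Path objects -/

section

variable (X : ChainComplex A ℤ) [DecidableRel (ComplexShape.down ℤ).Rel]

attribute [local instance] ComplexShape.decidableRelSymm

/-- The path object of `X` projects onto the two copies of `X` by a degreewise split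
epimorphism. -/
lemma exists_section_pathObject (n : ℤ) :
    ∃ s₀ s₁ : X.X n ⟶ X.pathObject.X n,
      s₀ ≫ (HomologicalComplex.pathObject.π₀ X).f n = 𝟙 _ ∧
      s₀ ≫ (HomologicalComplex.pathObject.π₁ X).f n = 0 ∧
      s₁ ≫ (HomologicalComplex.pathObject.π₀ X).f n = 0 ∧
      s₁ ≫ (HomologicalComplex.pathObject.π₁ X).f n = 𝟙 _ := by
  -- The path object is dual to the cylinder, a homotopy cofiber with target `X.op ⊞ X.op`; `r` is
  -- its degreewise projection to that target.
  let r := HomologicalComplex.homotopyCofiber.sndX (biprod.lift (𝟙 X.op) (-𝟙 X.op)) n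
  have h₀ : (HomologicalComplex.cylinder.ι₀ X.op).f n ≫ r =
      (biprod.inl : X.op ⟶ X.op ⊞ X.op).f n := by
    rw [HomologicalComplex.cylinder.ι₀, HomologicalComplex.comp_f, Category.assoc]
    refine (congrArg _ (HomologicalComplex.homotopyCofiber.inrX_sndX _ n)).trans
      (Category.comp_id _)
  have h₁ : (HomologicalComplex.cylinder.ι₁ X.op).f n ≫ r =
      (biprod.inr : X.op ⟶ X.op ⊞ X.op).f n := by
    rw [HomologicalComplex.cylinder.ι₁, HomologicalComplex.comp_f, Category.assoc]
    refine (congrArg _ (HomologicalComplex.homotopyCofiber.inrX_sndX _ n)).trans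
      (Category.comp_id _)
  refine ⟨(r ≫ (biprod.fst : X.op ⊞ X.op ⟶ X.op).f n).unop,
    (r ≫ (biprod.snd : X.op ⊞ X.op ⟶ X.op).f n).unop, ?_, ?_, ?_, ?_⟩
  · change ((HomologicalComplex.cylinder.ι₀ X.op).f n ≫ r ≫
      (biprod.fst : X.op ⊞ X.op ⟶ X.op).f n).unop = _
    rw [reassoc_of% h₀, ← HomologicalComplex.comp_f, biprod.inl_fst]
    rfl
  · change ((HomologicalComplex.cylinder.ι₁ X.op).f n ≫ r ≫
      (biprod.fst : X.op ⊞ X.op ⟶ X.op).f n).unop = _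
    rw [reassoc_of% h₁, ← HomologicalComplex.comp_f, biprod.inr_fst]
    rfl
  · change ((HomologicalComplex.cylinder.ι₀ X.op).f n ≫ r ≫
      (biprod.snd : X.op ⊞ X.op ⟶ X.op).f n).unop = _
    rw [reassoc_of% h₀, ← HomologicalComplex.comp_f, biprod.inl_snd]
    rfl
  · change ((HomologicalComplex.cylinder.ι₁ X.op).f n ≫ r ≫
      (biprod.snd : X.op ⊞ X.op ⟶ X.op).f n).unop = _
    rw [reassoc_of% h₁, ← HomologicalComplex.comp_f, biprod.inr_snd]
    rfl

end

section

variable {X Y : ChainComplex A ℤ}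

lemma biprod_total_f (n : ℤ) :
    (biprod.fst : X ⊞ Y ⟶ X).f n ≫ (biprod.inl : X ⟶ X ⊞ Y).f n +
      (biprod.snd : X ⊞ Y ⟶ Y).f n ≫ (biprod.inr : Y ⟶ X ⊞ Y).f n = 𝟙 _ := by
  rw [← HomologicalComplex.comp_f, ← HomologicalComplex.comp_f,
    ← HomologicalComplex.add_f_apply, biprod.total, HomologicalComplex.id_f]

lemma biprod_f_hom_ext {P : A} {n : ℤ} {u w : P ⟶ (X ⊞ Y).X n}
    (h : u ≫ (biprod.fst : X ⊞ Y ⟶ X).f n = w ≫ (biprod.fst : X ⊞ Y ⟶ X).f n)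
    (h' : u ≫ (biprod.snd : X ⊞ Y ⟶ Y).f n = w ≫ (biprod.snd : X ⊞ Y ⟶ Y).f n) : u = w := by
  rw [← Category.comp_id u, ← Category.comp_id w, ← biprod_total_f, Preadditive.comp_add,
    Preadditive.comp_add, reassoc_of% h, reassoc_of% h']

end

/-! ### The model structure given by a determining set -/

namespace ProjectiveClass

variable (PC : ProjectiveClass A)

lemma rlp_generatingCofibrations {PC : ProjectiveClass A} {S : Set A}
    (hS : PC.IsDeterminedBy S) :
    (generatingCofibrations S).rlp = PC.fibrations ⊓ PC.equivalences := by
  ext X Y f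
  rw [fibrations_inf_equivalences_iff, generatingCofibrations, rlp_ofHoms_iff]
  trans ∀ P ∈ S, ElementLifting P f
  · simp only [elementLifting_iff_hasLiftingProperty, Prod.forall, Subtype.forall]
  · simp only [elementLifting_iff_corner]
    have h (n : ℤ) := hS.2 (corner f n)
    exact ⟨fun h' P hP n => (h n).1 (fun P hP => h' P hP n) P hP,
      fun h' P hP n => (h n).2 (fun P hP => h' P hP n) P hP⟩

lemma rlp_generatingTrivialCofibrations {PC : ProjectiveClass A} {S : Set A}
    (hS : PC.IsDeterminedBy S) {Z : ChainComplex A ℤ} (hZ : IsZero Z) :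
    (generatingTrivialCofibrations S hZ).rlp = PC.fibrations := by
  ext X Y f
  rw [fibrations_iff, generatingTrivialCofibrations, rlp_ofHoms_iff]
  trans ∀ P ∈ S, ElementSurjective P f
  · simp only [elementSurjective_iff_hasLiftingProperty _ hZ, Prod.forall, Subtype.forall]
  · have h (n : ℤ) := hS.2 (f.f n)
    exact ⟨fun h' P hP n => (h n).1 (fun P hP => h' P hP n) P hP,
      fun h' P hP n => (h n).2 (fun P hP => h' P hP n) P hP⟩

lemma fibrations_to_isZero {X Z : ChainComplex A ℤ} (hZ : IsZero Z) (f : X ⟶ Z) :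
    PC.fibrations f := by
  rw [fibrations_iff]
  intro P _ n y
  refine ⟨0, ?_⟩
  have : IsZero (Z.X n) := (HomologicalComplex.eval A _ n).map_isZero hZ
  exact this.eq_of_tgt _ _

lemma fibrations_pathObject (X : ChainComplex A ℤ) [DecidableRel (ComplexShape.down ℤ).Rel] :
    PC.fibrations (biprod.lift (HomologicalComplex.pathObject.π₀ X)
      (HomologicalComplex.pathObject.π₁ X)) := by
  rw [fibrations_iff]
  intro P _ n y
  obtain ⟨s₀, s₁, h₀₀, h₀₁, h₁₀, h₁₁⟩ := exists_section_pathObject X n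
  refine ⟨y ≫ (biprod.fst : X ⊞ X ⟶ X).f n ≫ s₀ + y ≫ (biprod.snd : X ⊞ X ⟶ X).f n ≫ s₁, ?_⟩
  apply biprod_f_hom_ext
  · dsimp only
    rw [Category.assoc, ← HomologicalComplex.comp_f, biprod.lift_fst]
    simp only [Preadditive.add_comp, Category.assoc, h₀₀, h₁₀, Category.comp_id, comp_zero,
      add_zero]
  · dsimp only
    rw [Category.assoc, ← HomologicalComplex.comp_f, biprod.lift_snd]
    simp only [Preadditive.add_comp, Category.assoc, h₀₁, h₁₁, Category.comp_id, comp_zero,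
      zero_add]

/-- Such a map is a chain homotopy equivalence: lifting against `X ⟶ 0` gives a retraction, and
lifting against the path object fibration of `Y` gives the homotopy for the other composite. -/
lemma llp_fibrations_le_equivalences : PC.fibrations.llp ≤ PC.equivalences := by
  classical
  intro X Y f hf
  obtain ⟨Z, hZ⟩ := HasZeroObject.zero (C := ChainComplex A ℤ)
  have : HasLiftingProperty f (hZ.from_ X) := hf _ (PC.fibrations_to_isZero hZ _)
  have sq : CommSq (𝟙 X) f (hZ.from_ X) (hZ.from_ Y) := ⟨hZ.eq_of_tgt _ _⟩
  have hr : f ≫ sq.lift = 𝟙 X := sq.fac_left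
  let p : Y.pathObject ⟶ Y ⊞ Y := biprod.lift (HomologicalComplex.pathObject.π₀ Y)
    (HomologicalComplex.pathObject.π₁ Y)
  have hp : PC.fibrations p := PC.fibrations_pathObject Y
  have : HasLiftingProperty f p := hf _ hp
  have sq' : CommSq (f ≫ HomologicalComplex.pathObject.ι Y) f p
      (biprod.lift (𝟙 Y) (sq.lift ≫ f)) := by
    refine ⟨?_⟩
    apply biprod.hom_ext <;> simp [p, reassoc_of% hr]
  have hh : Homotopy (𝟙 Y) (sq.lift ≫ f) := by
    have h := (HomologicalComplex.pathObject.homotopy₀₁ Y (fun i => ⟨i - 1, by simp⟩)).compLeft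
      sq'.lift
    have e₁ : sq'.lift ≫ HomologicalComplex.pathObject.π₀ Y = 𝟙 Y := by
      simpa only [p, biprod.lift_fst, Category.assoc] using sq'.fac_right =≫ biprod.fst
    have e₂ : sq'.lift ≫ HomologicalComplex.pathObject.π₁ Y = sq.lift ≫ f := by
      simpa only [p, biprod.lift_snd, Category.assoc] using sq'.fac_right =≫ biprod.snd
    exact (Homotopy.ofEq e₁.symm).trans (h.trans (Homotopy.ofEq e₂))
  exact PC.homotopyEquivalences_le _ ⟨⟨f, sq.lift, Homotopy.ofEq hr, hh.symm⟩, rfl⟩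

lemma llp_fibrations_le_cofibrations : PC.fibrations.llp ≤ PC.cofibrations :=
  MorphismProperty.antitone_llp inf_le_left

/-- If every map factors as a map with the left lifting property with respect to fibrations
followed by a fibration, then the former are the trivial cofibrations. -/
lemma llp_fibrations_eq [MorphismProperty.HasFactorization PC.fibrations.llp PC.fibrations] :
    PC.fibrations.llp = PC.cofibrations ⊓ PC.equivalences := by
  refine le_antisymm
    (le_inf PC.llp_fibrations_le_cofibrations PC.llp_fibrations_le_equivalences) ?_
  rintro X Y f ⟨hf, hf'⟩
  have h := MorphismProperty.factorizationData PC.fibrations.llp PC.fibrations f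
  have hp : PC.equivalences h.p := PC.equivalences.of_precomp h.i h.p
    (PC.llp_fibrations_le_equivalences _ h.hi) (by rwa [h.fac])
  have := hf h.p ⟨h.hp, hp⟩
  exact MorphismProperty.of_retract (RetractArrow.ofLeftLiftingProperty h.fac) h.hi

lemma relativeModelStructureExists_and_isCofibrantlyGenerated [HasLimits A] [HasColimits A]
    (hsmall : ∀ X : A, IsSmallObject X) (h : PC.IsDeterminedBySet) :
    PC.RelativeModelStructureExists ∧ IsCofibrantlyGenerated PC.equivalences PC.cofibrations := by
  obtain ⟨S, hS, hS'⟩ := h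
  obtain ⟨Z, hZ'⟩ := HasZeroObject.zero (C := A)
  -- The zero complex is presented as a sphere, so that one smallness lemma covers the domains of
  -- `I` and of `J`.
  have hZ : IsZero (sphere Z 0) := isZero_sphere hZ' 0
  let I := generatingCofibrations S
  let J := generatingTrivialCofibrations S hZ
  have hIs : ∀ ⦃X Y : ChainComplex A ℤ⦄ (i : X ⟶ Y), I i → IsSmallObject X := by
    rintro _ _ _ ⟨p⟩
    exact isSmallObject_sphere (hsmall _) _
  have hJs : ∀ ⦃X Y : ChainComplex A ℤ⦄ (i : X ⟶ Y), J i → IsSmallObject X := by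
    rintro _ _ _ ⟨p⟩
    exact isSmallObject_sphere (hsmall _) _
  have hI : I.rlp = PC.fibrations ⊓ PC.equivalences := rlp_generatingCofibrations hS'
  have hJ : J.rlp = PC.fibrations := rlp_generatingTrivialCofibrations hS' hZ
  have hI' : I.rlp.llp = PC.cofibrations := by rw [hI]; rfl
  have := hasSmallObjectArgument_of_isSmallObject I hIs
  have := hasSmallObjectArgument_of_isSmallObject J hJs
  have fI : I.rlp.llp.HasFunctorialFactorization I.rlp := inferInstance
  have fJ : J.rlp.llp.HasFunctorialFactorization J.rlp := inferInstance
  rw [hI', hI] at fI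
  rw [hJ] at fJ
  have hJ' : PC.fibrations.llp = PC.cofibrations ⊓ PC.equivalences := PC.llp_fibrations_eq
  rw [hJ'] at fJ
  refine ⟨⟨inferInstance, inferInstance, ?_, fJ, fI⟩, I, J, inferInstance, inferInstance,
    fun _ _ i hi => (hIs i hi).isSmallRel _, fun _ _ i hi => (hJs i hi).isSmallRel _, hI',
    by rw [hJ, hJ']⟩
  let w : CategoryWithWeakEquivalences (ChainComplex A ℤ) := ⟨PC.equivalences⟩
  let c : CategoryWithCofibrations (ChainComplex A ℤ) := ⟨PC.cofibrations⟩
  let f : CategoryWithFibrations (ChainComplex A ℤ) := ⟨PC.fibrations⟩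
  have : (weakEquivalences (ChainComplex A ℤ)).HasTwoOutOfThreeProperty :=
    inferInstanceAs PC.equivalences.HasTwoOutOfThreeProperty
  have w₁ : MorphismProperty.IsWeakFactorizationSystem (HomotopicalAlgebra.cofibrations (ChainComplex A ℤ))
      (trivialFibrations (ChainComplex A ℤ)) :=
    { hasFactorization :=
        inferInstanceAs (PC.cofibrations.HasFactorization (PC.fibrations ⊓ PC.equivalences))
      llp := rfl
      rlp := by
        change PC.cofibrations.rlp = PC.fibrations ⊓ PC.equivalences
        rw [← hI', MorphismProperty.rlp_llp_rlp, hI] }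
  have w₂ : MorphismProperty.IsWeakFactorizationSystem (trivialCofibrations (ChainComplex A ℤ))
      (HomotopicalAlgebra.fibrations (ChainComplex A ℤ)) :=
    { hasFactorization :=
        inferInstanceAs ((PC.cofibrations ⊓ PC.equivalences).HasFactorization PC.fibrations)
      llp := hJ'
      rlp := by
        change (PC.cofibrations ⊓ PC.equivalences).rlp = PC.fibrations
        rw [← hJ', ← hJ, MorphismProperty.rlp_llp_rlp] }
  exact ⟨ModelCategory.mk' _, rfl, rfl, rfl⟩

end ProjectiveClass

/-! ### Cofibrations degree by degree, and the determining set given by generating cofibrations -/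

lemma hasLiftingProperty_iff_of_isZero {D : Type u} [Category.{v} D] {X Q B C : D} (hX : IsZero X)
    (i : X ⟶ Q) (g : B ⟶ C) :
    HasLiftingProperty i g ↔ IsElementEpic Q g := by
  constructor
  · intro h q
    have sq : CommSq (hX.to_ B) i g q := ⟨hX.eq_of_src _ _⟩
    exact ⟨sq.lift, sq.fac_right⟩
  · intro h
    refine ⟨fun {u w} sq => ?_⟩
    obtain ⟨q, hq⟩ := h w
    exact ⟨⟨⟨q, hX.eq_of_src _ _, hq⟩⟩⟩

section

/-- Since `Y` splits as `X ⊕ cokernel i`, only the second summand poses a lifting problem. -/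
lemma hasLiftingProperty_iff_of_isSplitMono {X Y B C : A} (i : X ⟶ Y) [IsSplitMono i]
    (g : B ⟶ C) : HasLiftingProperty i g ↔ IsElementEpic (cokernel i) g := by
  constructor
  · intro h q
    have sq : CommSq 0 i g (cokernel.π i ≫ q) := ⟨by simp⟩
    refine ⟨cokernel.desc i sq.lift sq.fac_left, ?_⟩
    dsimp only
    rw [← cancel_epi (cokernel.π i), cokernel.π_desc_assoc, sq.fac_right]
  · intro h
    refine ⟨fun {u w} sq => ?_⟩
    let s : cokernel i ⟶ Y := cokernel.desc i (𝟙 _ - retraction i ≫ i) (by simp)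
    have hs : cokernel.π i ≫ s = 𝟙 _ - retraction i ≫ i := cokernel.π_desc _ _ _
    obtain ⟨q, hq⟩ := h (s ≫ w)
    dsimp only at hq
    refine ⟨⟨⟨retraction i ≫ u + cokernel.π i ≫ q, by simp, ?_⟩⟩⟩
    rw [Preadditive.add_comp, Category.assoc, Category.assoc, hq, sq.w, reassoc_of% hs]
    simp

lemma isZero_disk {M : A} (hM : IsZero M) (n : ℤ) : IsZero (disk M n) := by
  rw [IsZero.iff_id_eq_zero]
  exact to_disk_hom_ext (hM.eq_of_tgt _ _)

lemma isZero_disk_X (M : A) {n k : ℤ} (h₀ : k ≠ n + 1) (h₁ : k ≠ n) : IsZero ((disk M n).X k) :=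
  HomologicalComplex.isZero_double_X _ _ _ h₀ h₁

lemma isZero_sphere_X (M : A) {n k : ℤ} (h : k ≠ n) : IsZero ((sphere M n).X k) :=
  HomologicalComplex.isZero_single_obj_X _ _ _ _ h

/-- Transposing leaves one degree of the inclusion: `0 ⟶ P` in the top degree of the disk, an
isomorphism in every other. -/
lemma hasLiftingProperty_sphereToDisk_diskMap_iff (P : A) {B C : A} (g : B ⟶ C) (n m : ℤ) :
    HasLiftingProperty (sphereToDisk P n) (diskMap g m) ↔
      (m = n + 1 + 1 → IsElementEpic P g) := by
  rw [hasLiftingProperty_diskMap_iff]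
  by_cases h : m = n + 1 + 1
  · subst h
    have e : IsElementEpic ((disk P (n + 1)).X (n + 1 + 1)) g ↔ IsElementEpic P g := by
      let e := diskXTop P (n + 1)
      constructor
      · intro h p
        obtain ⟨q, hq⟩ := h (e.hom ≫ p)
        dsimp only at hq
        exact ⟨e.inv ≫ q, by simp [hq]⟩
      · intro h p
        obtain ⟨q, hq⟩ := h (e.inv ≫ p)
        dsimp only at hq
        exact ⟨e.hom ≫ q, by simp [hq]⟩
    rw [hasLiftingProperty_iff_of_isZero (isZero_sphere_X _ (by simp)), e]
    simp
  · simp only [h, false_imp_iff, iff_true]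
    have : IsIso ((sphereToDisk P n).f m) := by
      by_cases h' : m = n + 1
      · subst h'
        rw [sphereToDisk_f]
        infer_instance
      · exact ⟨0, (isZero_sphere_X _ h').eq_of_src _ _, (isZero_disk_X _ h h').eq_of_src _ _⟩
    infer_instance

lemma elementLifting_diskMap_iff (P : A) {B C : A} (g : B ⟶ C) (m : ℤ) :
    ElementLifting P (diskMap g m) ↔ IsElementEpic P g := by
  simp only [elementLifting_iff_hasLiftingProperty, hasLiftingProperty_sphereToDisk_diskMap_iff]
  exact ⟨fun h => h (m - 1 - 1) (by simp), fun h _ _ => h⟩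

lemma elementLifting_iff_elementExact (P : A) {X Z : ChainComplex A ℤ} (hZ : IsZero Z)
    (f : X ⟶ Z) : ElementLifting P f ↔ ElementExact P X := by
  have hZ' (n : ℤ) : IsZero (Z.X n) := (HomologicalComplex.eval A _ n).map_isZero hZ
  constructor
  · intro h n x hx
    obtain ⟨y, hy, -⟩ := h n x 0 hx ((hZ' _).eq_of_tgt _ _)
    exact ⟨y, hy⟩
  · intro h n x y hx _
    obtain ⟨y, hy⟩ := h n x hx
    exact ⟨y, hy, (hZ' _).eq_of_tgt _ _⟩

lemma elementExact_disk (P M : A) (n : ℤ) : ElementExact P (disk M n) := by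
  obtain ⟨Z, hZ⟩ := HasZeroObject.zero (C := A)
  rw [← elementLifting_iff_elementExact P (isZero_disk hZ n) (diskMap (hZ.from_ M) n),
    elementLifting_diskMap_iff]
  exact fun _ => ⟨0, hZ.eq_of_tgt _ _⟩

lemma elementExact_biprod {P : A} {X Y : ChainComplex A ℤ} (hX : ElementExact P X)
    (hY : ElementExact P Y) : ElementExact P (X ⊞ Y) := by
  intro n x hx
  obtain ⟨y, hy⟩ := hX n (x ≫ (biprod.fst : X ⊞ Y ⟶ X).f _)
    (by rw [Category.assoc, (biprod.fst : X ⊞ Y ⟶ X).comm, reassoc_of% hx, zero_comp])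
  obtain ⟨z, hz⟩ := hY n (x ≫ (biprod.snd : X ⊞ Y ⟶ Y).f _)
    (by rw [Category.assoc, (biprod.snd : X ⊞ Y ⟶ Y).comm, reassoc_of% hx, zero_comp])
  refine ⟨y ≫ (biprod.inl : X ⟶ X ⊞ Y).f _ + z ≫ (biprod.inr : Y ⟶ X ⊞ Y).f _, ?_⟩
  rw [Preadditive.add_comp, Category.assoc, Category.assoc, (biprod.inl : X ⟶ X ⊞ Y).comm,
    (biprod.inr : Y ⟶ X ⊞ Y).comm, reassoc_of% hy, reassoc_of% hz, ← Preadditive.comp_add,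
    biprod_total_f, Category.comp_id]

end

namespace ProjectiveClass

variable (PC : ProjectiveClass A)

lemma fibrations_inf_equivalences_diskMap {B C : A} {g : B ⟶ C} (hg : PC.epi g) (n : ℤ) :
    (PC.fibrations ⊓ PC.equivalences) (diskMap g n) := by
  rw [fibrations_inf_equivalences_iff]
  exact fun P hP => (elementLifting_diskMap_iff P g n).2 ((PC.epi_iff g).1 hg P hP)

lemma hasLiftingProperty_f_of_cofibrations {X Y : ChainComplex A ℤ} {i : X ⟶ Y}
    (hi : PC.cofibrations i) (n : ℤ) {B C : A} {g : B ⟶ C} (hg : PC.epi g) :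
    HasLiftingProperty (i.f n) g := by
  rw [← hasLiftingProperty_diskMap_iff]
  exact hi _ (PC.fibrations_inf_equivalences_diskMap hg n)

/-- The map from `X.X n` to zero is a relative epimorphism; lifting the identity against it gives a
retraction. -/
lemma isSplitMono_f_of_cofibrations {X Y : ChainComplex A ℤ} {i : X ⟶ Y}
    (hi : PC.cofibrations i) (n : ℤ) : IsSplitMono (i.f n) := by
  obtain ⟨Z, hZ⟩ := HasZeroObject.zero (C := A)
  have hg : PC.epi (hZ.from_ (X.X n)) :=
    (PC.epi_iff _).2 fun P _ _ => ⟨0, hZ.eq_of_tgt _ _⟩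
  have := PC.hasLiftingProperty_f_of_cofibrations hi n hg
  have sq : CommSq (𝟙 _) (i.f n) (hZ.from_ (X.X n)) (hZ.from_ _) := ⟨hZ.eq_of_tgt _ _⟩
  exact ⟨⟨⟨sq.lift, sq.fac_left⟩⟩⟩

lemma cokernel_f_mem_proj_of_cofibrations {X Y : ChainComplex A ℤ} {i : X ⟶ Y}
    (hi : PC.cofibrations i) (n : ℤ) : cokernel (i.f n) ∈ PC.proj := by
  have := PC.isSplitMono_f_of_cofibrations hi n
  rw [PC.mem_proj_iff]
  intro B D g hg
  rw [← hasLiftingProperty_iff_of_isSplitMono]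
  exact PC.hasLiftingProperty_f_of_cofibrations hi n hg

lemma X_mem_proj_of_cofibrations {Z X : ChainComplex A ℤ} (hZ : IsZero Z) {i : Z ⟶ X}
    (hi : PC.cofibrations i) (n : ℤ) : X.X n ∈ PC.proj := by
  rw [PC.mem_proj_iff]
  intro B D g hg
  rw [← hasLiftingProperty_iff_of_isZero ((HomologicalComplex.eval A _ n).map_isZero hZ) (i.f n)]
  exact PC.hasLiftingProperty_f_of_cofibrations hi n hg

lemma cofibrations_sphereToDisk {P : A} (hP : P ∈ PC.proj) (n : ℤ) :
    PC.cofibrations (sphereToDisk P n) := by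
  intro X Y f hf
  rw [fibrations_inf_equivalences_iff] at hf
  exact (elementLifting_iff_hasLiftingProperty P f).1 (hf P hP) n

/-- If `g` is epic for the cokernels of the components of `I`, then `diskMap g 0` lifts against `I`,
hence against all cofibrations. Among these are the sphere inclusions on every relative projective.
-/
lemma isDeterminedBySet_of_isCofibrantlyGenerated
    (h : IsCofibrantlyGenerated PC.equivalences PC.cofibrations) : PC.IsDeterminedBySet := by
  obtain ⟨I, -, hI, -, -, -, hI', -⟩ := h
  have hle : I ≤ PC.cofibrations := hI' ▸ I.le_llp_rlp
  let S : Set A := Set.range fun p : I.toSet × ℤ => cokernel (p.1.1.hom.f p.2)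
  have hS : S ⊆ PC.proj := by
    rintro _ ⟨⟨i, n⟩, rfl⟩
    exact PC.cokernel_f_mem_proj_of_cofibrations (hle _ i.2) n
  refine ⟨S, small_range _, hS, fun B D g => ⟨fun hg P hP => ?_, fun hg P hP => hg P (hS hP)⟩⟩
  have hg' : I.rlp (diskMap g 0) := by
    intro X Y i hi
    rw [hasLiftingProperty_diskMap_iff]
    have := PC.isSplitMono_f_of_cofibrations (hle _ hi) 0
    rw [hasLiftingProperty_iff_of_isSplitMono]
    exact hg _ ⟨⟨⟨Arrow.mk i, hi⟩, 0⟩, rfl⟩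
  rw [← MorphismProperty.rlp_llp_rlp, hI'] at hg'
  exact (elementLifting_diskMap_iff P g 0).1
    ((elementLifting_iff_hasLiftingProperty _ _).2
      fun n => hg' _ (PC.cofibrations_sphereToDisk hP n))

end ProjectiveClass

/-! ### Zero objects and zero maps in the homotopy category -/

section

variable {C : Type*} [Category* C] {H : Type*} [Category* H] (L : C ⥤ H)

/-- `L.map 0` also factors through `Z`, by way of a preimage of `Z`, and parallel maps through a
zero object agree. -/
lemma map_eq_map_zero_of_isZeroMap [HasZeroMorphisms C] [L.EssSurj] {X Y : C} {f : X ⟶ Y} (hf : IsZeroMap (L.map f)) :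
    L.map f = L.map 0 := by
  obtain ⟨Z, hZ, a, b, hab⟩ := hf
  let e := L.objObjPreimageIso Z
  have h : L.map (0 : X ⟶ Y) = L.map (0 : X ⟶ L.objPreimage Z) ≫ L.map 0 := by
    rw [← L.map_comp, comp_zero]
  rw [h, ← hab, hZ.eq_of_tgt a (L.map 0 ≫ e.hom), hZ.eq_of_src b (e.inv ≫ L.map 0)]
  simp

/-- The maps to and from `Z` are natural transformations between `L` and a constant functor. They
descend to the localization and are the identity at `L.obj Z`, so naturality gives uniqueness. -/
lemma isZero_obj_of_isLocalization (W : MorphismProperty C) [L.IsLocalization W] {Z : C}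
    (hZ : IsZero Z) : IsZero (L.obj Z) := by
  have := Localization.essSurj L W
  let τ : L ⟶ L ⋙ (Functor.const H).obj (L.obj Z) :=
    { app X := L.map (hZ.from_ X)
      naturality X Y f := by
        simp [← L.map_comp, hZ.eq_of_tgt (f ≫ hZ.from_ Y) (hZ.from_ X)] }
  let σ : L ⋙ (Functor.const H).obj (L.obj Z) ⟶ L :=
    { app X := L.map (hZ.to_ X)
      naturality X Y f := by
        simp [← L.map_comp, hZ.eq_of_src (hZ.to_ X ≫ f) (hZ.to_ Y)] }
  let τ' := Localization.liftNatTrans L W L (L ⋙ (Functor.const H).obj (L.obj Z)) (𝟭 H)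
    ((Functor.const H).obj (L.obj Z)) τ
  let σ' := Localization.liftNatTrans L W (L ⋙ (Functor.const H).obj (L.obj Z)) L
    ((Functor.const H).obj (L.obj Z)) (𝟭 H) σ
  have hτ : τ'.app (L.obj Z) = 𝟙 _ := by
    simp [τ', τ, hZ.eq_of_src (hZ.from_ Z) (𝟙 Z)]
  have hσ : σ'.app (L.obj Z) = 𝟙 _ := by
    simp [σ', σ, hZ.eq_of_src (hZ.to_ Z) (𝟙 Z)]
  refine ⟨fun Y => ⟨⟨⟨σ'.app Y⟩, fun f => ?_⟩⟩, fun Y => ⟨⟨⟨τ'.app Y⟩, fun f => ?_⟩⟩⟩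
  · have := σ'.naturality f
    rw [hσ] at this
    simpa using this.symm
  · have := τ'.naturality f
    rw [hτ] at this
    simpa using this

end

lemma exists_d_eq_of_homologyMap_eq_zero {K L : ChainComplex AddCommGrpCat.{v} ℤ} (f : K ⟶ L)
    (n : ℤ) (h : HomologicalComplex.homologyMap f (n + 1) = 0) (x : K.X (n + 1))
    (hx : K.d (n + 1) n x = 0) :
    ∃ y : L.X (n + 1 + 1), L.d (n + 1 + 1) (n + 1) y = f.f (n + 1) x := by
  have h₁ := ShortComplex.exact_of_f_is_kernel
    (ShortComplex.mk _ _ (K.iCycles_d (n + 1) n)) (K.cyclesIsKernel (n + 1) n (by simp))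
  have h₂ := ShortComplex.exact_of_g_is_cokernel
    (ShortComplex.mk _ _ (L.toCycles_comp_homologyπ (n + 1 + 1) (n + 1)))
    (L.homologyIsCokernel (n + 1 + 1) (n + 1) (by simp))
  rw [ShortComplex.ab_exact_iff] at h₁ h₂
  obtain ⟨c, hc⟩ := h₁ x hx
  obtain ⟨y, hy⟩ := h₂ (HomologicalComplex.cyclesMap f (n + 1) c) (by
    have := ConcreteCategory.congr_hom (HomologicalComplex.homologyπ_naturality f (n + 1)) c
    rw [h, comp_zero] at this
    exact this.symm)
  refine ⟨y, ?_⟩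
  have h₃ := ConcreteCategory.congr_hom (L.toCycles_i (n + 1 + 1) (n + 1)) y
  have h₄ := ConcreteCategory.congr_hom (HomologicalComplex.cyclesMap_i f (n + 1)) c
  refine h₃.symm.trans ((congrArg _ hy).trans (h₄.trans (congrArg _ hc)))

section

variable {H : Type*} [Category* H]

lemma IsZeroMap.comp_left {X Y Z : H} (f : X ⟶ Y) {g : Y ⟶ Z} (hg : IsZeroMap g) :
    IsZeroMap (f ≫ g) := by
  obtain ⟨W, hW, a, b, rfl⟩ := hg
  exact ⟨W, hW, f ≫ a, b, Category.assoc _ _ _⟩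

lemma IsZeroMap.comp_right {X Y Z : H} {f : X ⟶ Y} (hf : IsZeroMap f) (g : Y ⟶ Z) :
    IsZeroMap (f ≫ g) := by
  obtain ⟨W, hW, a, b, rfl⟩ := hf
  exact ⟨W, hW, a, b ≫ g, (Category.assoc _ _ _).symm⟩

end

namespace ProjectiveClass

variable (PC : ProjectiveClass A)

/-- The homology of `A(P, -)` inverts the equivalences, so it cannot distinguish `f` from `0`. -/
lemma exists_comp_d_eq_of_isZeroMap {X Y : ChainComplex A ℤ} {f : X ⟶ Y}
    (hf : IsZeroMap (PC.equivalences.Q.map f)) {P : A} (hP : P ∈ PC.proj) {n : ℤ}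
    (x : P ⟶ X.X (n + 1)) (hx : x ≫ X.d (n + 1) n = 0) :
    ∃ y : P ⟶ Y.X (n + 1 + 1), y ≫ Y.d (n + 1 + 1) (n + 1) = x ≫ f.f (n + 1) := by
  have := Localization.essSurj PC.equivalences.Q PC.equivalences
  have hf' : AreEqualizedByLocalization PC.equivalences f 0 := map_eq_map_zero_of_isZeroMap _ hf
  let F := elementsComplex P ⋙ HomologicalComplex.homologyFunctor _ _ (n + 1)
  have hF : PC.equivalences.IsInvertedBy F := by
    intro X Y g hg
    have := hg P hP
    exact inferInstanceAs (IsIso (HomologicalComplex.homologyMap ((elementsComplex P).map g) _))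
  have h : HomologicalComplex.homologyMap ((elementsComplex P).map f) (n + 1) = 0 := by
    refine (hf'.map_eq_of_isInvertedBy F hF).trans ?_
    change HomologicalComplex.homologyMap ((elementsComplex P).map 0) (n + 1) = 0
    rw [Functor.map_zero, HomologicalComplex.homologyMap_zero]
  exact exists_d_eq_of_homologyMap_eq_zero _ n h x hx

lemma elementExact_of_isZero {X : ChainComplex A ℤ} (hX : IsZero (PC.equivalences.Q.obj X)) {P : A}
    (hP : P ∈ PC.proj) : ElementExact P X := by
  intro n x hx
  obtain ⟨y, hy⟩ := PC.exists_comp_d_eq_of_isZeroMap (f := 𝟙 X)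
    ⟨_, hX, 𝟙 _, 𝟙 _, by simp⟩ hP x hx
  exact ⟨y, by simpa using hy⟩

lemma isZero_of_elementExact {X : ChainComplex A ℤ} (hX : ∀ P ∈ PC.proj, ElementExact P X) :
    IsZero (PC.equivalences.Q.obj X) := by
  obtain ⟨Z, hZ⟩ := HasZeroObject.zero (C := ChainComplex A ℤ)
  have h : PC.equivalences (hZ.from_ X) := ((PC.fibrations_inf_equivalences_iff _).2
    fun P hP => (elementLifting_iff_elementExact P hZ _).2 (hX P hP)).2
  have := Localization.inverts PC.equivalences.Q PC.equivalences _ h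
  exact (isZero_obj_of_isLocalization PC.equivalences.Q PC.equivalences hZ).of_iso
    (asIso (PC.equivalences.Q.map (hZ.from_ X)))

lemma elementExact_of_isDeterminedBy {PC : ProjectiveClass A} {S : Set A}
    (hS : PC.IsDeterminedBy S) {X : ChainComplex A ℤ} (hX : ∀ P ∈ S, ElementExact P X) {P : A}
    (hP : P ∈ PC.proj) : ElementExact P X := by
  obtain ⟨Z, hZ⟩ := HasZeroObject.zero (C := ChainComplex A ℤ)
  have h : (generatingCofibrations S).rlp (hZ.from_ X) := by
    rw [generatingCofibrations, rlp_ofHoms_iff]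
    rintro ⟨P, n⟩
    exact (elementLifting_iff_hasLiftingProperty _ _).1
      ((elementLifting_iff_elementExact _ hZ _).2 (hX _ P.2)) n
  rw [rlp_generatingCofibrations hS, fibrations_inf_equivalences_iff] at h
  exact (elementLifting_iff_elementExact _ hZ _).1 (h P hP)

/-- Spheres on a determining set generate: if all maps from them are zero, every cycle bounds on
elements of that set, hence on those of all relative projectives. -/
lemma hasSetOfWeakGenerators_of_isDeterminedBySet (h : PC.IsDeterminedBySet) :
    HasSetOfWeakGenerators.{v} PC.HomotopyCat := by
  obtain ⟨S, hS, hS'⟩ := h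
  have : Small.{v} (S × ℤ) := inferInstance
  let L := PC.equivalences.Q
  have := Localization.essSurj L PC.equivalences
  refine ⟨Set.range fun p : S × ℤ => L.obj (sphere p.1.1 p.2), small_range _, fun X hX => ?_⟩
  by_contra! hX'
  refine hX (IsZero.of_iso (PC.isZero_of_elementExact fun P hP =>
    elementExact_of_isDeterminedBy hS' (fun P hP n x hx => ?_) hP) (L.objObjPreimageIso X).symm)
  have h := (hX' _ ⟨⟨⟨P, hP⟩, n + 1⟩, rfl⟩
    (L.map (sphereDesc x hx) ≫ (L.objObjPreimageIso X).hom)).comp_right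
    (L.objObjPreimageIso X).inv
  rw [Category.assoc, Iso.hom_inv_id, Category.comp_id] at h
  -- Applied to the tautological cycle of the sphere, whose image is `x`.
  obtain ⟨y, hy⟩ := PC.exists_comp_d_eq_of_isZeroMap h (hS'.1 hP) (sphereX P (n + 1)).inv
    (by rw [sphere_d, comp_zero])
  refine ⟨y, hy.trans ?_⟩
  rw [sphereDesc_f, Iso.inv_hom_id_assoc]

/-- Maps in the homotopy category from a cofibrant complex come from chain maps. -/
lemma map_Q_surjective (h : PC.RelativeModelStructureExists) {Z X : ChainComplex A ℤ}
    (hZ : IsZero Z) {i : Z ⟶ X} (hi : PC.cofibrations i) (Y : ChainComplex A ℤ) :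
    Function.Surjective
      (PC.equivalences.Q.map : (X ⟶ Y) → (PC.equivalences.Q.obj X ⟶ PC.equivalences.Q.obj Y)) := by
  obtain ⟨-, -, ⟨M, hW, hC, hF⟩, -, -⟩ := h
  have : PC.equivalences.Q.IsLocalization (weakEquivalences (ChainComplex A ℤ)) := by
    change PC.equivalences.Q.IsLocalization M.categoryWithWeakEquivalences.weakEquivalences
    rw [hW]
    infer_instance
  have : IsCofibrant X := by
    rw [isCofibrant_iff_of_isInitial i hZ.isInitial, cofibration_iff]
    change M.categoryWithCofibrations.cofibrations i
    rwa [hC]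
  have : IsFibrant Y := by
    rw [isFibrant_iff_of_isTerminal (hZ.from_ Y) hZ.isTerminal, fibration_iff]
    change M.categoryWithFibrations.fibrations _
    rw [hF]
    exact PC.fibrations_to_isZero hZ _
  exact map_surjective_of_isLocalization PC.equivalences.Q X Y

end ProjectiveClass

/-! ### The complex `ker g ⟶ B ⟶ C`, and the determining set given by weak generators -/

section

variable {B C : A} (g : B ⟶ C) (n : ℤ)

/-- The map from `disk C n` to `disk C (n + 1)` which is the identity of `C` in degree `n + 1`. -/
noncomputable def diskShift (C : A) (n : ℤ) : disk C n ⟶ disk C (n + 1) :=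
  toDisk (diskXTop C n).hom

/-- A complex isomorphic to the complex `ker g ⟶ B ⟶ C` with `C` in degree `n`. -/
noncomputable def kernelComplex : ChainComplex A ℤ :=
  pullback (diskMap g (n + 1)) (diskShift C n)

variable {g n}

/-- A map to this complex is a pair `u : X.X (n + 1) ⟶ B`, `w : X.X n ⟶ C` with `u ≫ g = d ≫ w`. A
lift `s` of `w` through `g` makes `u - d ≫ s` land in `ker g`, so the map factors through `disk B n
⊞ disk (kernel g) (n + 1)`, which is exact on elements. -/
lemma isZeroMap_map_to_kernelComplex (PC : ProjectiveClass A) {X : ChainComplex A ℤ}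
    (f : X ⟶ kernelComplex g n) (h₀ : IsElementEpic (X.X n) g) :
    IsZeroMap (PC.equivalences.Q.map f) := by
  let p : kernelComplex g n ⟶ disk B (n + 1) := pullback.fst _ _
  let q : kernelComplex g n ⟶ disk C n := pullback.snd _ _
  have hpq : p ≫ diskMap g (n + 1) = q ≫ diskShift C n := pullback.condition
  obtain ⟨u, hu⟩ : ∃ u, f ≫ p = toDisk u := ⟨_, eq_toDisk _⟩
  obtain ⟨w, hw⟩ : ∃ w, f ≫ q = toDisk w := ⟨_, eq_toDisk _⟩
  have huw : u ≫ g = X.d (n + 1) n ≫ w := by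
    have h : toDisk (u ≫ g) = toDisk ((toDisk w).f (n + 1) ≫ (diskXTop C n).hom) := by
      rw [← toDisk_diskMap, ← hu, Category.assoc, hpq, ← comp_toDisk, ← hw, Category.assoc]
      rfl
    have h' := congrArg (fun k => HomologicalComplex.Hom.f k (n + 1) ≫ (diskXBot C (n + 1)).hom) h
    simpa only [toDisk_f_bot, toDisk_f_top, Category.assoc, Iso.inv_hom_id,
      Category.comp_id] using h'
  obtain ⟨s, hs⟩ := h₀ w
  dsimp only at hs
  let t : X.X (n + 1) ⟶ kernel g := kernel.lift g (u - X.d _ _ ≫ s)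
    (by rw [Preadditive.sub_comp, Category.assoc, hs, huw, sub_self])
  have ht : t ≫ kernel.ι g = u - X.d _ _ ≫ s := kernel.lift_ι _ _ _
  let a : disk B n ⟶ kernelComplex g n := pullback.lift (diskShift B n) (diskMap g n) (by
    rw [diskShift, toDisk_diskMap, diskShift, comp_toDisk, diskMap, toDisk_f_top, disk_d]
    simp)
  let b : disk (kernel g) (n + 1) ⟶ kernelComplex g n :=
    pullback.lift (diskMap (kernel.ι g) (n + 1)) 0 (by
      rw [zero_comp, diskMap, toDisk_diskMap]
      exact to_disk_hom_ext (by simp [toDisk_f_bot]))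
  have hap : a ≫ p = diskShift B n := pullback.lift_fst _ _ _
  have haq : a ≫ q = diskMap g n := pullback.lift_snd _ _ _
  have hbp : b ≫ p = diskMap (kernel.ι g) (n + 1) := pullback.lift_fst _ _ _
  have hbq : b ≫ q = 0 := pullback.lift_snd _ _ _
  have hf : f = biprod.lift (toDisk s) (toDisk t) ≫ biprod.desc a b := by
    rw [biprod.lift_desc]
    apply pullback.hom_ext
    · change f ≫ p = (toDisk s ≫ a + toDisk t ≫ b) ≫ p
      rw [Preadditive.add_comp, Category.assoc, Category.assoc, hap, hbp, toDisk_diskMap, hu, ht,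
        diskShift, comp_toDisk]
      apply to_disk_hom_ext
      simp [toDisk_f_bot, toDisk_f_top]
    · change f ≫ q = (toDisk s ≫ a + toDisk t ≫ b) ≫ q
      rw [Preadditive.add_comp, Category.assoc, Category.assoc, haq, hbq, toDisk_diskMap, hw, hs,
        comp_zero, add_zero]
  have hD : IsZero (PC.equivalences.Q.obj (disk B n ⊞ disk (kernel g) (n + 1))) :=
    PC.isZero_of_elementExact fun P _ =>
      elementExact_biprod (elementExact_disk _ _ _) (elementExact_disk _ _ _)
  exact ⟨_, hD, _, _, by rw [hf, Functor.map_comp]⟩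

/-- An element `c` of `C` is a cycle in the lowest degree; the `B`-part of a chain bounding it is a
preimage under `g`. -/
lemma isElementEpic_of_elementExact_kernelComplex {P : A}
    (h : ElementExact P (kernelComplex g (n + 1))) : IsElementEpic P g := by
  intro c
  let p : kernelComplex g (n + 1) ⟶ disk B (n + 1 + 1) := pullback.fst _ _
  let q : kernelComplex g (n + 1) ⟶ disk C (n + 1) := pullback.snd _ _
  have hpq : p ≫ diskMap g (n + 1 + 1) = q ≫ diskShift C (n + 1) := pullback.condition
  let k : sphere P (n + 1) ⟶ disk C (n + 1) := sphereDesc (c ≫ (diskXBot C (n + 1)).inv)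
    ((isZero_disk_X C (by lia) (by simp)).eq_of_tgt _ _)
  let r : sphere P (n + 1) ⟶ kernelComplex g (n + 1) := pullback.lift 0 k
    (to_disk_hom_ext (((isZero_sphere_X P (by simp)).eq_of_src _ _)))
  have hrq : r ≫ q = k := pullback.lift_snd _ _ _
  obtain ⟨y, hy⟩ := h n ((sphereX P (n + 1)).inv ≫ r.f (n + 1))
    (by rw [Category.assoc, r.comm, sphere_d, zero_comp, comp_zero])
  refine ⟨y ≫ p.f _ ≫ (diskXBot B (n + 1 + 1)).hom, ?_⟩
  have h₁ : (diskMap g (n + 1 + 1)).f _ ≫ (diskXBot C (n + 1 + 1)).hom =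
      (diskXBot B (n + 1 + 1)).hom ≫ g := by
    rw [diskMap, toDisk_f_bot, Category.assoc, Category.assoc, Iso.inv_hom_id, Category.comp_id]
  have h₂ : (diskShift C (n + 1)).f _ ≫ (diskXBot C (n + 1 + 1)).hom =
      (disk C (n + 1)).d _ _ ≫ (diskXBot C (n + 1)).hom := by
    rw [diskShift, toDisk_f_bot, disk_d, Category.assoc, Category.assoc, Iso.inv_hom_id,
      Iso.inv_hom_id]
  dsimp only
  rw [Category.assoc, Category.assoc, ← h₁, ← HomologicalComplex.comp_f_assoc, hpq,
    HomologicalComplex.comp_f_assoc, h₂, q.comm_assoc, reassoc_of% hy,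
    ← HomologicalComplex.comp_f_assoc, hrq, sphereDesc_f, Category.assoc, Iso.inv_hom_id_assoc,
    Category.assoc, Iso.inv_hom_id, Category.comp_id]

end

namespace ProjectiveClass

variable (PC : ProjectiveClass A)

lemma isDeterminedBySet_of_hasSetOfWeakGenerators (h : PC.RelativeModelStructureExists)
    (hG : HasSetOfWeakGenerators.{v} PC.HomotopyCat) : PC.IsDeterminedBySet := by
  obtain ⟨G, hG, hG'⟩ := hG
  obtain ⟨Z, hZ⟩ := HasZeroObject.zero (C := ChainComplex A ℤ)
  let L := PC.equivalences.Q
  have := Localization.essSurj L PC.equivalences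
  have hfac := h.2.2.2.2
  have hres (X : PC.HomotopyCat) : ∃ (Y : ChainComplex A ℤ) (i : Z ⟶ Y),
      PC.cofibrations i ∧ Nonempty (L.obj Y ≅ X) := by
    let d := MorphismProperty.factorizationData PC.cofibrations
      (PC.fibrations ⊓ PC.equivalences) (hZ.to_ (L.objPreimage X))
    have := Localization.inverts L PC.equivalences _ d.hp.2
    exact ⟨d.Z, d.i, d.hi, ⟨asIso (L.map d.p) ≪≫ L.objObjPreimageIso X⟩⟩
  choose Y i hi e using hres
  -- The components of cofibrant replacements of the generators.
  let S : Set A := Set.range fun p : G × ℤ => (Y p.1.1).X p.2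
  have hS : S ⊆ PC.proj := by
    rintro _ ⟨⟨X, n⟩, rfl⟩
    exact PC.X_mem_proj_of_cofibrations hZ (hi _) n
  refine ⟨S, small_range _, hS, fun B D g => ⟨fun hg P hP => ?_, fun hg P hP => hg P (hS hP)⟩⟩
  refine isElementEpic_of_elementExact_kernelComplex (n := 0)
    (PC.elementExact_of_isZero ?_ hP)
  by_contra hK
  obtain ⟨X, hX, f, hf⟩ := hG' _ hK
  obtain ⟨e⟩ := e X
  -- The source is cofibrant and every complex is fibrant, so the map of the homotopy category is
  -- represented by a chain map `φ`.
  obtain ⟨φ, hφ⟩ := PC.map_Q_surjective h hZ (hi X) _ (e.hom ≫ f)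
  have hφ' := isZeroMap_map_to_kernelComplex PC φ (hg _ ⟨⟨⟨X, hX⟩, _⟩, rfl⟩)
  rw [hφ] at hφ'
  refine hf ?_
  simpa using hφ'.comp_left e.inv

end ProjectiveClass

end RelHom

theorem mainTheorem2 {A : Type u} [Category.{v} A] [Abelian A] [HasLimits A] [HasColimits A]
    (hsmall : ∀ X : A, RelHom.IsSmallObject X) (PC : RelHom.ProjectiveClass A) :
    List.TFAE
      [PC.IsDeterminedBySet,
       PC.RelativeModelStructureExists ∧
         RelHom.IsCofibrantlyGenerated PC.equivalences PC.cofibrations,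
       PC.RelativeModelStructureExists ∧
         RelHom.HasSetOfWeakGenerators.{v} PC.HomotopyCat] ∧
    (PC.RelativeModelStructureExists ∧ RelHom.HasSetOfWeakGenerators.{v} PC.HomotopyCat →
      PC.IsDeterminedBySetOfSmallObjects) := by
  refine ⟨?_, fun h => ?_⟩
  · tfae_have 1 → 2 := PC.relativeModelStructureExists_and_isCofibrantlyGenerated hsmall
    tfae_have 2 → 1 := fun h => PC.isDeterminedBySet_of_isCofibrantlyGenerated h.2
    tfae_have 1 → 3 := fun h =>
      ⟨(PC.relativeModelStructureExists_and_isCofibrantlyGenerated hsmall h).1,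
        PC.hasSetOfWeakGenerators_of_isDeterminedBySet h⟩
    tfae_have 3 → 1 := fun h => PC.isDeterminedBySet_of_hasSetOfWeakGenerators h.1 h.2
    tfae_finish
  · obtain ⟨S, hS, hS'⟩ := PC.isDeterminedBySet_of_hasSetOfWeakGenerators h.1 h.2
    exact ⟨S, hS, hS', fun P _ => (hsmall P).isSmallRel _⟩
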